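/- Let $d\in\{1,2,3,\dots\}$, $\alpha\in(0,2)$, $\gamma\in[1,d]$, and write $\mathbb S=\{x\in\mathbb R^d:|x|=1\}$, $B(x,r)=\{y\in\mathbb R^d:|y-x|<r\}$. Let $\mu$ be a finite Borel measure on $\mathbb S$ and let $\bar q:(0,\infty)\to(0,\infty)$ be bounded and nonincreasing, and assume that for some constants $c>0$ and $K\ge 1$ $$\mu(B(\theta,r)\cap\mathbb S)\le c\,r^{\gamma-1},\quad \theta\in\mathbb S,\ 0<r<1/2,\qquad\qquad \bar q(s)\le K\,\bar q(2s),\quad s>0.$$ Let $c_0>0$. Then there is a constant $C$, depending only on $d,\alpha,\gamma,\mu,\bar q$ and $c_0$, with the following property. Let $\nu$ be a symmetric Lévy measure on $\mathbb R^d$ (a Borel measure with $\nu(\{0\})=0$, $\int\min(1,|y|^2)\,\nu(dy)<\infty$ and $\nu(-A)=\nu(A)$) such that $$\nu(A)\le\int_{\mathbb S}\int_0^\infty \mathbf 1_A(s\theta)\,s^{-1-\alpha}\,\bar q(s)\,ds\,\mu(d\theta)\quad\text{for all Borel } A\subset\mathbb R^d,$$ and such that $\Phi(\xi)=\int(1-\cos\langle\xi,y\rangle)\,\nu(dy)$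 satisfies $\Phi(\xi)\ge c_0|\xi|^\alpha$ for $|\xi|>1$. Let $\{P_t\}_{t\ge0}$ be the convolution semigroup of probability measures on $\mathbb R^d$ with Fourier transform $\mathcal F(P_t)(\xi)=e^{-t\Phi(\xi)}$ (it exists and is unique). Then for every $t>0$ the measure $P_t$ has a smooth bounded density $p_t$ with respect to Lebesgue measure, and $$p_t(x)\le C\min\left(t^{-d/\alpha},\ t^{1+\frac{\gamma-d}{\alpha}}\,|x|^{-\alpha-\gamma}\,\bar q(|x|)\right),\qquad x\in\mathbb R^d,\ t\in(0,1),$$ where for $x=0$ the minimum is read as $t^{-d/\alpha}$. Moreover there is a constant $C'>0$ such that for all $x\ne0$ and $t\in(0,1)$ $$\frac1{C'}\,m_t(x)\le t^{-d/\alpha}\left(1+t^{-1/\alpha}|x|\right)^{-\alpha-\gamma}\bar q(|x|)\le C'\,m_t(x),$$ where $m_t(x)$ denotes the above minimum. -/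

import Mathlib

open MeasureTheory Set
open scoped ContDiff

/-- A symmetric Lévy measure on `ℝ^d`: no mass at the origin, `∫ min(1, |y|²) ν(dy) < ∞`, and
invariance under `y ↦ -y`. -/
structure IsSymmLevyMeasure {d : ℕ} (ν : Measure (EuclideanSpace ℝ (Fin d))) : Prop where
  zero_mass : ν {0} = 0
  lintegral_lt_top : ∫⁻ y, ENNReal.ofReal (min 1 (‖y‖ ^ 2)) ∂ν < ⊤
  symm : ν.map (fun y => -y) = ν

/-- The Lévy–Khinchin exponent `Φ(ξ) = ∫ (1 - cos ⟨ξ, y⟩) ν(dy)`. -/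
noncomputable def levyExponent {d : ℕ} (ν : Measure (EuclideanSpace ℝ (Fin d)))
    (ξ : EuclideanSpace ℝ (Fin d)) : ℝ :=
  ∫ y, (1 - Real.cos (inner ℝ ξ y)) ∂ν

/-- `P` (restricted to times `t ≥ 0`) is the convolution semigroup of probability measures whose
Fourier transform is `exp (-t Φ)`.  The last field determines `P t`, `t ≥ 0`, and entails
`P 0 = δ₀` and weak continuity in `t`. -/
structure IsLevySemigroup {d : ℕ} (ν : Measure (EuclideanSpace ℝ (Fin d)))
    (P : ℝ → Measure (EuclideanSpace ℝ (Fin d))) : Prop where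
  prob : ∀ t : ℝ, 0 ≤ t → IsProbabilityMeasure (P t)
  conv : ∀ s t : ℝ, 0 ≤ s → 0 ≤ t → P (s + t) = Measure.conv (P s) (P t)
  charFun_eq : ∀ t : ℝ, 0 ≤ t → ∀ ξ : EuclideanSpace ℝ (Fin d),
    charFun (P t) ξ = ((Real.exp (-(t * levyExponent ν ξ)) : ℝ) : ℂ)

/-- `f` is a smooth bounded density of the measure `Q` with respect to Lebesgue measure.  Being
continuous, it is the only such function. -/
structure IsSmoothBoundedDensity {d : ℕ} (Q : Measure (EuclideanSpace ℝ (Fin d)))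
    (f : EuclideanSpace ℝ (Fin d) → ℝ) : Prop where
  smooth : ContDiff ℝ ∞ f
  nonneg : ∀ x, 0 ≤ f x
  bounded : ∃ M : ℝ, ∀ x, f x ≤ M
  eq_withDensity : Q = volume.withDensity (fun x => ENNReal.ofReal (f x))

/-- The polar measure `∫_S ∫_0^∞ 1_A(sθ) s^{-1-α} q(s) ds μ(dθ)` of a set `A`, for a measure `μ`
on the unit sphere. -/
noncomputable def polarMass {d : ℕ} (α : ℝ) (q : ℝ → ℝ)
    (μ : Measure (Metric.sphere (0 : EuclideanSpace ℝ (Fin d)) 1))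
    (A : Set (EuclideanSpace ℝ (Fin d))) : ENNReal :=
  ∫⁻ θ, (∫⁻ s in Ioi (0 : ℝ),
    A.indicator (fun _ => ENNReal.ofReal (s ^ (-1 - α) * q s))
      (s • (θ : EuclideanSpace ℝ (Fin d)))) ∂μ

/-- `min (t^{-d/α}, t^{1+(γ-d)/α} |x|^{-α-γ} q(|x|))`, meaningful for `t > 0` and `r = |x| > 0`. -/
noncomputable def densityBound (d : ℕ) (α γ : ℝ) (q : ℝ → ℝ) (t r : ℝ) : ℝ :=
  min (t ^ (-(d : ℝ) / α)) (t ^ (1 + (γ - d) / α) * r ^ (-α - γ) * q r)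

/-! Put `ε = t^(1/α)` and `R = |x|`. The bound `Φ(ξ) ≥ c₀|ξ|^α` makes `exp(-tΦ)` integrable against
every power of `|ξ|`; Fourier inversion then gives a smooth density, and the scaling `ξ ↦ t^(1/α) ξ`
gives the bound `t^(-d/α)`. This settles `R < Lε` for any fixed `L`, since there `(ε/R)^(α+γ) q(R)`
is bounded below.

For `R ≥ Lε` the jumps are cut at `ρ = R/L`. Write `P_t` as the convolution of the law `L_ρ` of the
jumps below `ρ` with the compound Poisson law of `l = tν` restricted to `|y| ≥ ρ`. Comparing series
coefficients, the compound Poisson law `N` satisfies `N ≤ δ₀ + l ∗ N`, so `P_t ≤ L_ρ + L_ρ ∗ l ∗ N`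
(`le_law_add_smul`).

The first term is negligible near `x`: a Chernoff bound gives tails of the form `(t/ρ^α)^(const ·
R/ρ)`, and since `R/ρ = L` is at our disposal, this is an arbitrarily high power of `ε/R`. It
therefore beats `(ε/R)^(α+γ) q(R)`, because doubling lets `q` decay only polynomially. Writing the
law at time `t` as the convolution square of the law at time `t/2` turns the tail bound into a
density bound (`conv_self_apply_le`).

For the second term, factor out of `L_ρ` the law `S` of the jumps below `ε`; the remaining factors
are probabilities and preserve uniform density bounds. The density of `S` is `t^(-d/α)` times a
geometric weight on annuli of width `ε`, while `l` gives a ball of radius `r` mass at most a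
constant times `t r^γ ρ^(-α-γ) q(ρ)`. Summing over annuli bounds `S ∗ l` by a constant times
`t^(-d/α) (ε/ρ)^(α+γ) q(ρ)`, and doubling replaces `ρ` by `R`. -/

/-! ### Convolution powers and compound Poisson laws. -/

section Convolution

open Measure

theorem conv_apply {E : Type*} [AddMonoid E] [MeasurableSpace E] [MeasurableAdd₂ E]
    (μ ν : Measure E) [SFinite ν] {A : Set E} (hA : MeasurableSet A) :
    (μ ∗ ν) A = ∫⁻ x, ν ((fun y => x + y) ⁻¹' A) ∂μ := by
  rw [← lintegral_indicator_one hA, lintegral_conv (measurable_one.indicator hA)]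
  refine lintegral_congr fun x => ?_
  rw [← lintegral_indicator_one (measurable_const_add x hA)]
  rfl

theorem conv_mono_right {E : Type*} [AddMonoid E] [MeasurableSpace E] [MeasurableAdd₂ E]
    (μ : Measure E) {ν ν' : Measure E} [SFinite ν] [SFinite ν'] (h : ν ≤ ν') :
    μ ∗ ν ≤ μ ∗ ν' := by
  refine Measure.le_iff.2 fun A hA => ?_
  rw [conv_apply _ _ hA, conv_apply _ _ hA]
  exact lintegral_mono fun x => h _

/-- The `n`-fold convolution power of a measure. -/
noncomputable def convPow {E : Type*} [AddMonoid E] [MeasurableSpace E] (l : Measure E) :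
    ℕ → Measure E
  | 0 => dirac 0
  | n + 1 => l ∗ convPow l n

/-- The compound Poisson distribution with finite jump measure `l`. -/
noncomputable def compoundPoisson {E : Type*} [AddMonoid E] [MeasurableSpace E]
    (l : Measure E) : Measure E :=
  Measure.sum fun n : ℕ =>
    ENNReal.ofReal (Real.exp (-l.real univ) / n.factorial) • convPow l n

instance isFiniteMeasure_convPow {E : Type*} [AddMonoid E] [MeasurableSpace E]
    [MeasurableAdd₂ E] (l : Measure E) [IsFiniteMeasure l] (n : ℕ) :
    IsFiniteMeasure (convPow l n) := by
  induction n with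
  | zero => exact inferInstanceAs (IsFiniteMeasure (dirac 0))
  | succ n ih => exact inferInstanceAs (IsFiniteMeasure (l ∗ convPow l n))

variable {E : Type*} [NormedAddCommGroup E] [InnerProductSpace ℝ E] [FiniteDimensional ℝ E]
  [MeasurableSpace E] [BorelSpace E]

theorem charFun_convPow (l : Measure E) [IsFiniteMeasure l] (n : ℕ) (ξ : E) :
    charFun (convPow l n) ξ = charFun l ξ ^ n := by
  induction n with
  | zero => simp [convPow, charFun_dirac]
  | succ n ih => rw [convPow, charFun_conv, ih, pow_succ']

theorem lintegral_exp_convPow (l : Measure E) [IsFiniteMeasure l] (n : ℕ) (h : E) :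
    ∫⁻ y, ENNReal.ofReal (Real.exp (inner ℝ h y)) ∂(convPow l n)
      = (∫⁻ y, ENNReal.ofReal (Real.exp (inner ℝ h y)) ∂l) ^ n := by
  induction n with
  | zero => simp [convPow]
  | succ n ih =>
    rw [convPow, lintegral_conv (by fun_prop)]
    simp_rw [inner_add_right, Real.exp_add, ENNReal.ofReal_mul (Real.exp_nonneg _)]
    simp_rw [lintegral_const_mul _ (show Measurable fun y : E =>
      ENNReal.ofReal (Real.exp (inner ℝ h y)) by fun_prop)]
    rw [lintegral_mul_const _ (by fun_prop), ih, pow_succ']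

/-- The exponential moment is multiplicative under convolution, so the Poisson weights sum to an
exponential series in `M`. -/
theorem lintegral_exp_compoundPoisson (l : Measure E) [IsFiniteMeasure l] (h : E) {M : ℝ}
    (hM : ∫⁻ y, ENNReal.ofReal (Real.exp (inner ℝ h y)) ∂l = ENNReal.ofReal M) (hM0 : 0 ≤ M) :
    ∫⁻ y, ENNReal.ofReal (Real.exp (inner ℝ h y)) ∂(compoundPoisson l)
      = ENNReal.ofReal (Real.exp (M - l.real univ)) := by
  rw [compoundPoisson, lintegral_sum_measure]
  simp_rw [lintegral_smul_measure, lintegral_exp_convPow, hM, smul_eq_mul,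
    ← ENNReal.ofReal_pow hM0]
  have hs : HasSum (fun n : ℕ => Real.exp (-l.real univ) / n.factorial * M ^ n)
      (Real.exp (M - l.real univ)) := by
    have := (NormedSpace.expSeries_div_hasSum_exp M).mul_left (Real.exp (-l.real univ))
    rw [← Real.exp_eq_exp_ℝ, ← Real.exp_add] at this
    rw [show M - l.real univ = -l.real univ + M by ring]
    simpa only [div_mul_eq_mul_div, mul_div_assoc'] using this
  rw [← hs.tsum_eq, ENNReal.ofReal_tsum_of_nonneg (fun n => by positivity) hs.summable]
  refine tsum_congr fun n => ?_
  rw [ENNReal.ofReal_mul (by positivity)]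

instance isProbabilityMeasure_compoundPoisson (l : Measure E) [IsFiniteMeasure l] :
    IsProbabilityMeasure (compoundPoisson l) := by
  have := lintegral_exp_compoundPoisson l (0 : E) (M := l.real univ) (by simp) (by positivity)
  exact ⟨by simpa using this⟩

theorem charFun_compoundPoisson (l : Measure E) [IsFiniteMeasure l] (ξ : E) :
    charFun (compoundPoisson l) ξ = Complex.exp (charFun l ξ - l.real univ) := by
  have hint : Integrable (fun x : E => Complex.exp ((inner ℝ x ξ : ℝ) * Complex.I))
      (compoundPoisson l) := by
    refine (integrable_const (1 : ℝ)).mono (by fun_prop) ?_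
    simp [Complex.norm_exp_ofReal_mul_I]
  rw [charFun_apply, compoundPoisson, integral_sum_measure hint]
  simp_rw [integral_smul_measure, ← charFun_apply, charFun_convPow]
  have hs := (NormedSpace.expSeries_div_hasSum_exp (charFun l ξ)).mul_left
    (Complex.exp (-l.real univ))
  rw [← Complex.exp_eq_exp_ℂ, ← Complex.exp_add] at hs
  rw [show charFun l ξ - l.real univ = -l.real univ + charFun l ξ by ring, ← hs.tsum_eq]
  refine tsum_congr fun n => ?_
  rw [ENNReal.toReal_ofReal (by positivity), Complex.real_smul]
  push_cast
  ring

theorem conv_compoundPoisson_apply (l : Measure E) [IsFiniteMeasure l] {A : Set E}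
    (hA : MeasurableSet A) :
    (l ∗ compoundPoisson l) A = ∑' n : ℕ,
      ENNReal.ofReal (Real.exp (-l.real univ) / n.factorial) * convPow l (n + 1) A := by
  rw [conv_apply _ _ hA]
  have h (x : E) : compoundPoisson l ((fun y => x + y) ⁻¹' A) = ∑' n : ℕ,
      ENNReal.ofReal (Real.exp (-l.real univ) / n.factorial) *
        convPow l n ((fun y => x + y) ⁻¹' A) := by
    rw [compoundPoisson, sum_apply _ (measurable_const_add x hA)]
    simp
  have hm (n : ℕ) : Measurable fun x : E => convPow l n ((fun y => x + y) ⁻¹' A) :=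
    measurable_measure_prodMk_left (measurable_add hA)
  simp_rw [h]
  rw [lintegral_tsum fun n => ((hm n).const_mul _).aemeasurable]
  refine tsum_congr fun n => ?_
  rw [lintegral_const_mul _ (hm n), convPow, conv_apply _ _ hA]

/-- The term of order `n + 1` on the left has weight `1/(n+1)!` against `1/n!` on the right, and the
term of order `0` is at most `δ₀`. This isolates one jump without any smallness of `l`. -/
theorem compoundPoisson_le (l : Measure E) [IsFiniteMeasure l] :
    compoundPoisson l ≤ dirac 0 + l ∗ compoundPoisson l := by
  refine Measure.le_iff.2 fun A hA => ?_
  rw [add_apply, conv_compoundPoisson_apply l hA, compoundPoisson, sum_apply _ hA,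
    tsum_eq_zero_add' ENNReal.summable]
  simp only [Measure.smul_apply, smul_eq_mul]
  gcongr with n
  · refine (mul_le_mul_left (ENNReal.ofReal_le_one.2 ?_) _).trans (one_mul _).le
    simp
  · simp

end Convolution

open Filter Topology

/-! ### Existence of infinitely divisible laws with symmetric Lévy measure. -/

section LevyLaw

variable {d : ℕ} {ν : Measure (EuclideanSpace ℝ (Fin d))}

namespace IsSymmLevyMeasure

theorem lintegral_neg (hν : IsSymmLevyMeasure ν) {f : EuclideanSpace ℝ (Fin d) → ENNReal}
    (hf : Measurable f) : ∫⁻ y, f (-y) ∂ν = ∫⁻ y, f y ∂ν := by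
  conv_rhs => rw [← hν.symm, lintegral_map hf measurable_neg]

theorem integral_neg (hν : IsSymmLevyMeasure ν) (f : EuclideanSpace ℝ (Fin d) → ℂ) :
    ∫ y, f (-y) ∂ν = ∫ y, f y ∂ν := by
  conv_rhs => rw [← hν.symm]
  exact ((Homeomorph.neg (EuclideanSpace ℝ (Fin d))).measurableEmbedding.integral_map f).symm

theorem restrict (hν : IsSymmLevyMeasure ν) {S : Set (EuclideanSpace ℝ (Fin d))}
    (hS : MeasurableSet S) (hneg : ∀ y, -y ∈ S ↔ y ∈ S) : IsSymmLevyMeasure (ν.restrict S) where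
  zero_mass := le_antisymm ((Measure.restrict_apply_le _ _).trans hν.zero_mass.le) bot_le
  lintegral_lt_top := (setLIntegral_le_lintegral _ _).trans_lt hν.lintegral_lt_top
  symm := by
    conv_rhs => rw [← hν.symm, Measure.restrict_map measurable_neg hS]
    congr 2
    ext y
    exact (hneg y).symm

theorem smul (hν : IsSymmLevyMeasure ν) (t : ℝ) :
    IsSymmLevyMeasure (ENNReal.ofReal t • ν) where
  zero_mass := by simp [hν.zero_mass]
  lintegral_lt_top := by
    rw [lintegral_smul_measure]
    exact ENNReal.mul_lt_top ENNReal.ofReal_lt_top hν.lintegral_lt_top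
  symm := by rw [Measure.map_smul, hν.symm]

theorem integrable_min (hν : IsSymmLevyMeasure ν) : Integrable (fun y => min 1 (‖y‖ ^ 2)) ν := by
  refine ⟨by fun_prop, ?_⟩
  rw [hasFiniteIntegral_iff_ofReal (Eventually.of_forall fun y => by positivity)]
  exact hν.lintegral_lt_top

end IsSymmLevyMeasure

theorem one_sub_cos_inner_le (ξ y : EuclideanSpace ℝ (Fin d)) :
    1 - Real.cos (inner ℝ ξ y) ≤ (2 + ‖ξ‖ ^ 2) * min 1 (‖y‖ ^ 2) := by
  have h1 := Real.neg_one_le_cos (inner ℝ ξ y)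
  have h2 := Real.one_sub_sq_div_two_le_cos (x := inner ℝ ξ y)
  have h3 : (inner ℝ ξ y) ^ 2 ≤ ‖ξ‖ ^ 2 * ‖y‖ ^ 2 := by
    rw [← mul_pow, ← sq_abs]
    gcongr
    exact abs_real_inner_le_norm ξ y
  rcases le_total 1 (‖y‖ ^ 2) with h | h
  · rw [min_eq_left h]
    nlinarith [sq_nonneg ‖ξ‖]
  · rw [min_eq_right h]
    nlinarith [sq_nonneg ‖ξ‖, sq_nonneg ‖y‖, mul_nonneg (sq_nonneg ‖ξ‖) (sq_nonneg ‖y‖)]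

theorem one_sub_cos_nonneg (u : ℝ) : 0 ≤ 1 - Real.cos u := sub_nonneg.2 (Real.cos_le_one u)

namespace IsSymmLevyMeasure

theorem integrable_one_sub_cos (hν : IsSymmLevyMeasure ν) (ξ : EuclideanSpace ℝ (Fin d)) :
    Integrable (fun y => 1 - Real.cos (inner ℝ ξ y)) ν := by
  refine (hν.integrable_min.const_mul (2 + ‖ξ‖ ^ 2)).mono' (by fun_prop) ?_
  filter_upwards with y
  rw [Real.norm_of_nonneg (one_sub_cos_nonneg _)]
  exact one_sub_cos_inner_le ξ y

theorem continuousAt_levyExponent_zero (hν : IsSymmLevyMeasure ν) :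
    ContinuousAt (levyExponent ν) 0 := by
  refine continuousAt_of_dominated (bound := fun y => 3 * min 1 (‖y‖ ^ 2)) ?_ ?_
    (hν.integrable_min.const_mul 3) ?_
  · exact Eventually.of_forall fun ξ => by fun_prop
  · filter_upwards [Metric.ball_mem_nhds (0 : EuclideanSpace ℝ (Fin d)) one_pos] with ξ hξ
    filter_upwards with y
    rw [Real.norm_of_nonneg (one_sub_cos_nonneg _)]
    refine (one_sub_cos_inner_le ξ y).trans ?_
    have : ‖ξ‖ ^ 2 ≤ 1 := pow_le_one₀ (norm_nonneg _) (mem_ball_zero_iff.1 hξ).le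
    gcongr
    linarith
  · exact Eventually.of_forall fun y => by fun_prop

theorem measure_norm_ge_lt_top (hν : IsSymmLevyMeasure ν) {ρ : ℝ} (hρ : 0 < ρ) :
    ν {y | ρ ≤ ‖y‖} < ⊤ := by
  have hm : 0 < min 1 (ρ ^ 2) := by positivity
  have h := mul_meas_ge_le_lintegral₀ (μ := ν)
    (f := fun y : EuclideanSpace ℝ (Fin d) => ENNReal.ofReal (min 1 (‖y‖ ^ 2)))
    (by fun_prop) (ENNReal.ofReal (min 1 (ρ ^ 2)))
  have h2 : {y : EuclideanSpace ℝ (Fin d) | ρ ≤ ‖y‖} ⊆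
      {y | ENNReal.ofReal (min 1 (ρ ^ 2)) ≤ ENNReal.ofReal (min 1 (‖y‖ ^ 2))} := fun y hy => by
    have : ρ ≤ ‖y‖ := hy
    exact ENNReal.ofReal_le_ofReal (by gcongr)
  refine (measure_mono h2).trans_lt (lt_top_iff_ne_top.2 fun htop => ?_)
  rw [htop, ENNReal.mul_top (ENNReal.ofReal_pos.2 hm).ne'] at h
  exact absurd hν.lintegral_lt_top (by simpa using h)

theorem isFiniteMeasure_restrict (hν : IsSymmLevyMeasure ν) {ρ : ℝ} (hρ : 0 < ρ) :
    IsFiniteMeasure (ν.restrict {y | ρ ≤ ‖y‖}) :=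
  ⟨by simpa using hν.measure_norm_ge_lt_top hρ⟩

theorem restrict_norm_ge (hν : IsSymmLevyMeasure ν) (ρ : ℝ) :
    IsSymmLevyMeasure (ν.restrict {y | ρ ≤ ‖y‖}) :=
  hν.restrict (measurableSet_le (by fun_prop) (by fun_prop)) (by simp)

theorem restrict_norm_lt (hν : IsSymmLevyMeasure ν) (ρ : ℝ) :
    IsSymmLevyMeasure (ν.restrict {y | ‖y‖ < ρ}) :=
  hν.restrict (measurableSet_lt (by fun_prop) (by fun_prop)) (by simp)

theorem charFun_eq [IsFiniteMeasure ν] (hν : IsSymmLevyMeasure ν)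
    (ξ : EuclideanSpace ℝ (Fin d)) :
    charFun ν ξ = ((ν.real univ - levyExponent ν ξ : ℝ) : ℂ) := by
  have hint (ξ : EuclideanSpace ℝ (Fin d)) :
      Integrable (fun x => Complex.exp ((inner ℝ x ξ : ℝ) * Complex.I)) ν := by
    refine (integrable_const (1 : ℝ)).mono (by fun_prop) ?_
    simp [Complex.norm_exp_ofReal_mul_I]
  have h1 : (2 : ℂ) * charFun ν ξ = ∫ x, ((2 * Real.cos (inner ℝ ξ x) : ℝ) : ℂ) ∂ν := by
    rw [two_mul]
    conv_lhs => lhs; rw [charFun_apply, ← hν.integral_neg]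
    rw [charFun_apply, ← integral_add _ (hint ξ)]
    · refine integral_congr_ae (Eventually.of_forall fun x => ?_)
      simp only [inner_neg_left, real_inner_comm ξ x]
      push_cast
      rw [Complex.two_cos]
      ring_nf
    · simpa [inner_neg_left, inner_neg_right] using hint (-ξ)
  rw [integral_complex_ofReal, integral_const_mul] at h1
  have h2 : levyExponent ν ξ = ν.real univ - ∫ x, Real.cos (inner ℝ ξ x) ∂ν := by
    rw [levyExponent, integral_sub (integrable_const _)]
    · simp
    · refine (integrable_const (1 : ℝ)).mono (by fun_prop) ?_
      simpa using Eventually.of_forall fun x => Real.abs_cos_le_one _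
  rw [h2]
  push_cast at h1 ⊢
  linear_combination h1 / 2

theorem lintegral_exp_eq_cosh (hν : IsSymmLevyMeasure ν) (h : EuclideanSpace ℝ (Fin d)) :
    ∫⁻ y, ENNReal.ofReal (Real.exp (inner ℝ h y)) ∂ν
      = ∫⁻ y, ENNReal.ofReal (Real.cosh (inner ℝ h y)) ∂ν := by
  have h2 : 2 * ∫⁻ y, ENNReal.ofReal (Real.exp (inner ℝ h y)) ∂ν
      = 2 * ∫⁻ y, ENNReal.ofReal (Real.cosh (inner ℝ h y)) ∂ν := by
    have hm : Measurable fun y : EuclideanSpace ℝ (Fin d) =>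
      ENNReal.ofReal (Real.exp (inner ℝ h y)) := by fun_prop
    rw [two_mul, ← lintegral_const_mul _ (by fun_prop)]
    conv_lhs => rhs; rw [← hν.lintegral_neg hm]
    rw [← lintegral_add_left hm]
    refine lintegral_congr fun y => ?_
    rw [← ENNReal.ofReal_add (Real.exp_nonneg _) (Real.exp_nonneg _), two_mul,
      ← ENNReal.ofReal_add (Real.cosh_pos _).le (Real.cosh_pos _).le, Real.cosh_eq,
      inner_neg_right]
    congr 1
    ring
  exact (ENNReal.mul_right_inj (by norm_num) (by norm_num)).1 h2

/-- Chernoff bound. Symmetry replaces `exp - 1` by `cosh - 1` in the cumulant; this is quadratic at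
the origin, so the bound does not involve the total mass and survives approximation of an infinite
Lévy measure. -/
theorem compoundPoisson_inner_gt_le [IsFiniteMeasure ν] (hν : IsSymmLevyMeasure ν)
    (h : EuclideanSpace ℝ (Fin d)) {B : ℝ} (hB : 0 ≤ B) (r : ℝ)
    (hcosh : ∫⁻ y, ENNReal.ofReal (Real.cosh (inner ℝ h y) - 1) ∂ν ≤ ENNReal.ofReal B) :
    compoundPoisson ν {y | r < inner ℝ h y} ≤ ENNReal.ofReal (Real.exp (B - r)) := by
  have hle : ∫⁻ y, ENNReal.ofReal (Real.exp (inner ℝ h y)) ∂ν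
      ≤ ENNReal.ofReal (B + ν.real univ) := by
    rw [hν.lintegral_exp_eq_cosh, ENNReal.ofReal_add hB measureReal_nonneg, ofReal_measureReal]
    calc ∫⁻ y, ENNReal.ofReal (Real.cosh (inner ℝ h y)) ∂ν
        = ∫⁻ y, (ENNReal.ofReal (Real.cosh (inner ℝ h y) - 1) + 1) ∂ν := by
          refine lintegral_congr fun y => ?_
          rw [← ENNReal.ofReal_one, ← ENNReal.ofReal_add (by linarith [Real.one_le_cosh (inner ℝ h y)])
            zero_le_one, sub_add_cancel]
      _ ≤ _ := by
          rw [lintegral_add_right _ measurable_const]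
          simpa using hcosh
  obtain ⟨M, hM0, hM⟩ : ∃ M : ℝ, 0 ≤ M ∧
      ∫⁻ y, ENNReal.ofReal (Real.exp (inner ℝ h y)) ∂ν = ENNReal.ofReal M :=
    ⟨_, ENNReal.toReal_nonneg,
      (ENNReal.ofReal_toReal (hle.trans_lt ENNReal.ofReal_lt_top).ne).symm⟩
  have hMB : M ≤ B + ν.real univ := by
    rwa [hM, ENNReal.ofReal_le_ofReal_iff (by positivity)] at hle
  have hmk := mul_meas_ge_le_lintegral₀ (μ := compoundPoisson ν)
    (f := fun y => ENNReal.ofReal (Real.exp (inner ℝ h y))) (by fun_prop)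
    (ENNReal.ofReal (Real.exp r))
  rw [lintegral_exp_compoundPoisson ν h hM hM0] at hmk
  have hsub : {y : EuclideanSpace ℝ (Fin d) | r < inner ℝ h y} ⊆
      {y | ENNReal.ofReal (Real.exp r) ≤ ENNReal.ofReal (Real.exp (inner ℝ h y))} := fun y hy =>
    ENNReal.ofReal_le_ofReal (Real.exp_le_exp.2 (le_of_lt hy))
  calc compoundPoisson ν {y | r < inner ℝ h y}
      = ENNReal.ofReal (Real.exp (-r)) * (ENNReal.ofReal (Real.exp r) *
          compoundPoisson ν {y | r < inner ℝ h y}) := by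
        rw [← mul_assoc, ← ENNReal.ofReal_mul (Real.exp_nonneg _), ← Real.exp_add]
        simp
    _ ≤ ENNReal.ofReal (Real.exp (-r)) * ENNReal.ofReal (Real.exp (M - ν.real univ)) := by
        gcongr
        exact (mul_le_mul_right (measure_mono hsub) _).trans hmk
    _ ≤ ENNReal.ofReal (Real.exp (B - r)) := by
        rw [← ENNReal.ofReal_mul (Real.exp_nonneg _), ← Real.exp_add]
        refine ENNReal.ofReal_le_ofReal (Real.exp_le_exp.2 ?_)
        linarith

theorem tendsto_levyExponent_restrict (hν : IsSymmLevyMeasure ν)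
    (ξ : EuclideanSpace ℝ (Fin d)) :
    Tendsto (fun n : ℕ => levyExponent (ν.restrict {y | 1 / ((n : ℝ) + 1) ≤ ‖y‖}) ξ) atTop
      (𝓝 (levyExponent ν ξ)) := by
  have hU : (⋃ n : ℕ, {y : EuclideanSpace ℝ (Fin d) | 1 / ((n : ℝ) + 1) ≤ ‖y‖}) = {0}ᶜ := by
    ext y
    simp only [mem_iUnion, mem_ofPred_eq, mem_compl_iff, mem_singleton_iff]
    constructor
    · rintro ⟨n, hn⟩ rfl
      have : (0 : ℝ) < 1 / ((n : ℝ) + 1) := by positivity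
      simp only [norm_zero] at hn
      linarith
    · intro hy
      obtain ⟨n, hn⟩ := exists_nat_one_div_lt (norm_pos_iff.2 hy)
      exact ⟨n, hn.le⟩
  have hmono : Monotone fun n : ℕ =>
      {y : EuclideanSpace ℝ (Fin d) | 1 / ((n : ℝ) + 1) ≤ ‖y‖} := fun m n hmn y hy =>
    show 1 / ((n : ℝ) + 1) ≤ ‖y‖ from
      (Nat.one_div_le_one_div hmn).trans (show 1 / ((m : ℝ) + 1) ≤ ‖y‖ from hy)
  have := tendsto_setIntegral_of_monotone (μ := ν) (f := fun y => 1 - Real.cos (inner ℝ ξ y))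
    (fun n => measurableSet_le (by fun_prop) (by fun_prop)) hmono
    (hν.integrable_one_sub_cos ξ).integrableOn
  rw [hU, Measure.restrict_eq_self_of_ae_mem (s := {0}ᶜ)] at this
  · exact this
  · exact compl_mem_ae_iff.2 hν.zero_mass

/-- Existence of the infinitely divisible law with a given symmetric Lévy measure, with an
exponential tail bound. -/
theorem exists_law (hν : IsSymmLevyMeasure ν) :
    ∃ Q : Measure (EuclideanSpace ℝ (Fin d)), IsProbabilityMeasure Q ∧
      (∀ ξ, charFun Q ξ = ((Real.exp (-levyExponent ν ξ) : ℝ) : ℂ)) ∧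
      ∀ (h : EuclideanSpace ℝ (Fin d)) (B r : ℝ), 0 ≤ B →
        ∫⁻ y, ENNReal.ofReal (Real.cosh (inner ℝ h y) - 1) ∂ν ≤ ENNReal.ofReal B →
        Q {y | r < inner ℝ h y} ≤ ENNReal.ofReal (Real.exp (B - r)) := by
  have hfin (n : ℕ) : IsFiniteMeasure (ν.restrict {y | 1 / ((n : ℝ) + 1) ≤ ‖y‖}) :=
    hν.isFiniteMeasure_restrict (by positivity)
  let μ (n : ℕ) : ProbabilityMeasure (EuclideanSpace ℝ (Fin d)) :=
    ⟨compoundPoisson (ν.restrict {y | 1 / ((n : ℝ) + 1) ≤ ‖y‖}), inferInstance⟩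
  have hlim (ξ : EuclideanSpace ℝ (Fin d)) : Tendsto
      (fun n => charFun (μ n : Measure (EuclideanSpace ℝ (Fin d))) ξ) atTop
      (𝓝 ((Real.exp (-levyExponent ν ξ) : ℝ) : ℂ)) := by
    have hμ (n : ℕ) : charFun (μ n : Measure (EuclideanSpace ℝ (Fin d))) ξ = ((Real.exp
        (-levyExponent (ν.restrict {y | 1 / ((n : ℝ) + 1) ≤ ‖y‖}) ξ) : ℝ) : ℂ) := by
      change charFun (compoundPoisson (ν.restrict _)) ξ = _
      rw [charFun_compoundPoisson, (hν.restrict_norm_ge _).charFun_eq]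
      push_cast
      ring_nf
    simp_rw [hμ]
    exact (Complex.continuous_ofReal.tendsto _).comp ((Real.continuous_exp.tendsto _).comp
      (hν.tendsto_levyExponent_restrict ξ).neg)
  -- Continuity of the limiting exponent at `0` excludes escape of mass.
  have htight : IsTightMeasureSet
      (range fun n => (μ n : Measure (EuclideanSpace ℝ (Fin d)))) := by
    refine isTightMeasureSet_of_tendsto_charFun ?_ hlim
    have := hν.continuousAt_levyExponent_zero
    fun_prop
  have hcpt : IsCompact (closure (range μ)) := by
    refine isCompact_closure_of_isTightMeasureSet ?_
    convert htight using 1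
    ext m
    simp
  -- A limit along a nonprincipal ultrafilter is enough, since the characteristic functions converge
  -- along the whole sequence.
  obtain ⟨Q, -, hQ⟩ := hcpt.ultrafilter_le_nhds' ((hyperfilter ℕ).map μ)
    (mem_of_superset (Filter.mem_map.2 (Filter.univ_mem' fun n => mem_range_self n))
      subset_closure)
  have hchar (ξ : EuclideanSpace ℝ (Fin d)) :
      charFun (Q : Measure (EuclideanSpace ℝ (Fin d))) ξ
        = ((Real.exp (-levyExponent ν ξ) : ℝ) : ℂ) := by
    have h1 := (ProbabilityMeasure.tendsto_iff_forall_integral_rclike_tendsto ℂ).1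
      (show Tendsto μ (hyperfilter ℕ) (𝓝 Q) from hQ) (BoundedContinuousFunction.innerProbChar ξ)
    simp_rw [← charFun_eq_integral_innerProbChar] at h1
    exact tendsto_nhds_unique h1 ((hlim ξ).mono_left Nat.hyperfilter_le_atTop)
  refine ⟨Q, inferInstance, hchar, fun h B r hB hcosh => ?_⟩
  -- The strict inequality makes the half-space open, so its mass is lower semicontinuous under weak
  -- limits.
  refine (ProbabilityMeasure.le_liminf_measure_open_of_tendsto
    (show Tendsto μ (hyperfilter ℕ) (𝓝 Q) from hQ)
    (isOpen_lt continuous_const (by fun_prop))).trans ?_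
  refine liminf_le_of_frequently_le' (Frequently.of_forall fun n => ?_)
  exact (hν.restrict_norm_ge _).compoundPoisson_inner_gt_le h hB r
    ((setLIntegral_le_lintegral _ _).trans hcosh)

end IsSymmLevyMeasure

end LevyLaw

open scoped FourierTransform

/-! ### Smooth densities by Fourier inversion. -/

section FourierDensity

variable {E : Type*} [NormedAddCommGroup E] [InnerProductSpace ℝ E] [FiniteDimensional ℝ E]
  [MeasurableSpace E] [BorelSpace E]

/-- The density of `Q` recovered from its characteristic function by Fourier inversion. -/
noncomputable def fourierDensity (Q : Measure E) (x : E) : ℝ :=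
  (𝓕 (fun w : E => charFun Q ((2 * Real.pi) • w)) x).re

theorem integrable_charFun_smul {Q : Measure E} (h : Integrable (charFun Q)) :
    Integrable fun w : E => charFun Q ((2 * Real.pi) • w) :=
  h.comp_smul (by positivity)

theorem continuous_fourierDensity {Q : Measure E} (h : Integrable (charFun Q)) :
    Continuous (fourierDensity Q) :=
  Complex.continuous_re.comp (VectorFourier.fourierIntegral_continuous
    Real.continuous_fourierChar (innerSL ℝ).continuous₂ (integrable_charFun_smul h))

theorem abs_fourierDensity_le (Q : Measure E) (x : E) :
    |fourierDensity Q x| ≤ ∫ ξ, ‖charFun Q ξ‖ := by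
  refine (Complex.abs_re_le_norm _).trans
    ((VectorFourier.norm_fourierIntegral_le_integral_norm _ _ _ _ _).trans ?_)
  rw [Measure.integral_comp_smul volume (fun ξ => ‖charFun Q ξ‖)]
  refine (smul_le_of_le_one_left (integral_nonneg fun _ => norm_nonneg _) ?_)
  rw [abs_inv]
  refine inv_le_one_of_one_le₀ ?_
  rw [abs_of_nonneg (by positivity)]
  exact one_le_pow₀ (by linarith [Real.pi_gt_three])

theorem contDiff_fourierDensity {Q : Measure E}
    (h : ∀ n : ℕ, Integrable fun ξ => ‖ξ‖ ^ n * ‖charFun Q ξ‖) :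
    ContDiff ℝ ∞ (fourierDensity Q) := by
  have : ContDiff ℝ ∞ (𝓕 (fun w : E => charFun Q ((2 * Real.pi) • w))) := by
    refine Real.contDiff_fourier (N := ⊤) fun n _ => ?_
    have h1 := ((h n).comp_smul (R := 2 * Real.pi) (by positivity)).const_mul
      (((2 * Real.pi) ^ n)⁻¹)
    refine h1.congr (Eventually.of_forall fun ξ => ?_)
    simp only [norm_smul, mul_pow, Real.norm_eq_abs]
    rw [abs_of_pos (by positivity : 0 < 2 * Real.pi), mul_pow, mul_assoc,
      inv_mul_cancel_left₀ (by positivity)]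
  exact Complex.reCLM.contDiff.comp this

/-- With `φ = 𝓕 g`, self-adjointness of the Fourier transform, applied once against `Q` and once
against Lebesgue measure, turns both sides into the integral of `g` against the same characteristic
function. -/
theorem integral_eq_integral_mul_fourierDensity {Q : Measure E} [IsFiniteMeasure Q]
    (h : Integrable (charFun Q)) {φ : E → ℝ} (hφ : ContDiff ℝ ∞ φ) (hc : HasCompactSupport φ) :
    ∫ x, φ x ∂Q = ∫ x, φ x * fourierDensity Q x := by
  let φc : E → ℂ := fun x => (φ x : ℂ)
  have hcc : HasCompactSupport φc := hc.comp_left Complex.ofReal_zero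
  let f : SchwartzMap E ℂ := hcc.toSchwartzMap (Complex.ofRealCLM.contDiff.comp hφ)
  have hf : (f : E → ℂ) = φc := rfl
  let g : SchwartzMap E ℂ := 𝓕⁻ f
  have hg : (𝓕 (g : E → ℂ)) = φc := by
    rw [← SchwartzMap.fourier_coe, FourierTransform.fourier_fourierInv_eq, hf]
  have h1 : ∫ x, φc x ∂Q = ∫ v, g v * charFun Q ((2 * Real.pi) • -v) := by
    have := VectorFourier.integral_fourierIntegral_smul_eq_flip (μ := volume) (ν := Q)
      (f := g) (g := fun _ : E => (1 : ℂ)) (L := innerₗ E) Real.continuous_fourierChar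
      continuous_inner g.integrable (integrable_const _)
    simp only [smul_eq_mul, mul_one] at this
    rw [← hg]
    refine this.trans (integral_congr_ae (Eventually.of_forall fun v => ?_))
    simp only
    congr 1
    rw [charFun_eq_fourierIntegral', flip_innerₗ]
    rw [smul_smul, neg_mul, inv_mul_cancel₀ (by positivity)]
    simp only [neg_smul, one_smul, neg_neg]
    rfl
  have h2 : ∫ x, φc x * 𝓕 (fun w : E => charFun Q ((2 * Real.pi) • w)) x
      = ∫ v, g v * charFun Q ((2 * Real.pi) • -v) := by
    have := VectorFourier.integral_fourierIntegral_smul_eq_flip (μ := volume) (ν := volume)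
      (f := φc) (g := fun w : E => charFun Q ((2 * Real.pi) • w)) (L := innerₗ E)
      Real.continuous_fourierChar continuous_inner f.integrable (integrable_charFun_smul h)
    simp only [smul_eq_mul, flip_innerₗ] at this
    refine this.symm.trans ?_
    rw [← integral_neg_eq_self]
    refine integral_congr_ae (Eventually.of_forall fun v => ?_)
    simp only
    congr 1
  have h3 := congrArg Complex.re (h1.trans h2.symm)
  rw [integral_complex_ofReal, Complex.ofReal_re] at h3
  rw [h3, ← RCLike.re_eq_complex_re, ← integral_re]
  · refine integral_congr_ae (Eventually.of_forall fun x => ?_)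
    simp [φc, fourierDensity]
  · have hF : Continuous (𝓕 (fun w : E => charFun Q ((2 * Real.pi) • w))) :=
      VectorFourier.fourierIntegral_continuous
        Real.continuous_fourierChar (innerSL ℝ).continuous₂ (integrable_charFun_smul h)
    exact (f.continuous.mul hF).integrable_of_hasCompactSupport hcc.mul_right

/-- Smooth cutoffs between a compact set and an open neighbourhood compare `Q` with Lebesgue
measure; regularity extends this to Borel sets. It supplies the absolute continuity needed to
identify the density. -/
theorem measure_le_integral_norm_charFun {Q : Measure E} [IsFiniteMeasure Q]
    (h : Integrable (charFun Q)) :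
    Q ≤ ENNReal.ofReal (∫ ξ, ‖charFun Q ξ‖) • volume := by
  set M := ∫ ξ, ‖charFun Q ξ‖ with hM
  have hM0 : 0 ≤ M := integral_nonneg fun _ => norm_nonneg _
  have hKU {K U : Set E} (hK : IsCompact K) (hU : IsOpen U) (hKU : K ⊆ U) :
      Q K ≤ ENNReal.ofReal M * volume U := by
    obtain ⟨K', hK', hKK', hK'U⟩ := exists_compact_between hK hU hKU
    obtain ⟨φ, h1, h0, h01⟩ := exists_contMDiffMap_one_nhds_of_subset_interior (n := ⊤)
      (modelWithCornersSelf ℝ E) hK.isClosed hKK'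
    have hcs : HasCompactSupport φ := HasCompactSupport.intro hK' h0
    have hφd : ContDiff ℝ ∞ φ := φ.contMDiff.contDiff
    have hφi : Integrable φ Q := hφd.continuous.integrable_of_hasCompactSupport hcs
    have hφi' : Integrable (fun x => φ x * fourierDensity Q x) volume :=
      (hφd.continuous.mul (continuous_fourierDensity h)).integrable_of_hasCompactSupport
        hcs.mul_right
    have h3 : Q.real K ≤ ∫ x, φ x ∂Q := by
      rw [← integral_indicator_one hK.measurableSet]
      refine integral_mono ((integrable_const _).indicator hK.measurableSet) hφi fun x => ?_
      by_cases hx : x ∈ K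
      · simp [hx, h1.self_of_nhdsSet x hx]
      · simpa only [hx, not_false_eq_true, indicator_of_notMem] using (h01 x).1
    have h4 : ∫ x, φ x ∂Q ≤ M * volume.real K' := by
      rw [integral_eq_integral_mul_fourierDensity h hφd hcs, ← integral_indicator_one
        hK'.measurableSet, ← integral_const_mul]
      refine integral_mono hφi' (((integrable_indicator_iff hK'.measurableSet).2
        (integrableOn_const hK'.measure_lt_top.ne)).const_mul M) fun x => ?_
      by_cases hx : x ∈ K'
      · have h5 := (le_abs_self _).trans (abs_fourierDensity_le Q x)
        rw [← hM] at h5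
        simp only [hx, indicator_of_mem, Pi.one_apply, mul_one]
        nlinarith [(h01 x).1, (h01 x).2]
      · simp [hx, h0 x hx]
    calc Q K = ENNReal.ofReal (Q.real K) := by rw [ofReal_measureReal]
      _ ≤ ENNReal.ofReal M * volume K' := by
        rw [← ENNReal.ofReal_toReal hK'.measure_lt_top.ne, ← ENNReal.ofReal_mul hM0]
        exact ENNReal.ofReal_le_ofReal (h3.trans h4)
      _ ≤ _ := by gcongr
  refine Measure.le_iff.2 fun A hA => ?_
  rw [hA.measure_eq_iSup_isCompact_of_ne_top (measure_ne_top _ _), Measure.smul_apply,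
    smul_eq_mul]
  refine iSup₂_le fun K hKA => iSup_le fun hK => ?_
  refine le_trans ?_ (mul_le_mul_right (measure_mono hKA) _)
  refine ENNReal.le_of_forall_pos_le_add fun ε hε _ => ?_
  -- Dividing by `M + 1` instead of `M` covers the case `M = 0`.
  obtain ⟨U, hKU', hU, hlt⟩ := hK.exists_isOpen_lt_add (μ := volume)
    (ε := ε / ENNReal.ofReal (M + 1)) (by simpa using hε.ne')
  refine (hKU hK hU hKU').trans ((mul_le_mul_right hlt.le _).trans ?_)
  rw [mul_add]
  gcongr
  refine le_trans ?_ (ENNReal.mul_div_le (a := ENNReal.ofReal (M + 1)))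
  gcongr
  linarith

/-- The Radon–Nikodym derivative and `fourierDensity Q` have the same integrals against test
functions, hence agree almost everywhere; continuity makes nonnegativity hold everywhere. -/
theorem fourierDensity_nonneg_and_eq_withDensity {Q : Measure E} [IsFiniteMeasure Q]
    (h : Integrable (charFun Q)) : (∀ x, 0 ≤ fourierDensity Q x) ∧
      Q = volume.withDensity fun x => ENNReal.ofReal (fourierDensity Q x) := by
  have hac : Q ≪ volume :=
    (Measure.absolutelyContinuous_of_le (measure_le_integral_norm_charFun h)).trans
      (Measure.smul_absolutelyContinuous)
  have hae : ∀ᵐ x ∂volume, (Q.rnDeriv volume x).toReal = fourierDensity Q x := by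
    refine ae_eq_of_integral_contDiff_smul_eq Measure.integrable_toReal_rnDeriv.locallyIntegrable
      (continuous_fourierDensity h).locallyIntegrable fun φ hφ hc => ?_
    simp only [smul_eq_mul]
    rw [← integral_eq_integral_mul_fourierDensity h hφ hc,
      ← integral_toReal_rnDeriv_mul hac]
    simp only [mul_comm]
  refine ⟨fun x => ?_, ?_⟩
  · by_contra! hx
    have hopen : IsOpen {y | fourierDensity Q y < 0} :=
      isOpen_lt (continuous_fourierDensity h) continuous_const
    have hpos := hopen.measure_pos volume ⟨x, hx⟩
    refine hpos.ne' (measure_mono_null (fun y hy => ?_) hae)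
    intro hy2
    have hy2 : (Q.rnDeriv volume y).toReal = fourierDensity Q y := hy2
    have : fourierDensity Q y < 0 := hy
    linarith [ENNReal.toReal_nonneg (a := Q.rnDeriv volume y)]
  · conv_lhs => rw [← Measure.withDensity_rnDeriv_eq Q volume hac]
    refine withDensity_congr_ae ?_
    filter_upwards [hae, Q.rnDeriv_lt_top volume] with x hx hx'
    rw [← hx, ENNReal.ofReal_toReal hx'.ne]

end FourierDensity

/-! ### Tails of the law of the small jumps. -/

section SmallJumps

theorem cosh_sub_one_le (u : ℝ) : Real.cosh u - 1 ≤ u ^ 2 * Real.exp |u| := by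
  have key (u : ℝ) : Real.exp u - 1 - u ≤ u ^ 2 * Real.exp |u| := by
    have h := Complex.norm_exp_sub_sum_le_norm_mul_exp (u : ℂ) 2
    have h2 : Complex.exp u - ∑ m ∈ Finset.range 2, (u : ℂ) ^ m / m.factorial
        = ((Real.exp u - 1 - u : ℝ) : ℂ) := by
      simp [Finset.sum_range_succ]
      ring
    rw [h2, Complex.norm_real, Complex.norm_real, Real.norm_eq_abs, Real.norm_eq_abs, sq_abs] at h
    exact (le_abs_self _).trans h
  have h1 := key u
  have h2 := key (-u)
  rw [abs_neg, neg_sq] at h2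
  rw [Real.cosh_eq]
  linarith

variable {d : ℕ} {ν : Measure (EuclideanSpace ℝ (Fin d))}

namespace IsSymmLevyMeasure

/-- The infinitely divisible probability law with symmetric Lévy measure `ν`. -/
noncomputable def law (hν : IsSymmLevyMeasure ν) : Measure (EuclideanSpace ℝ (Fin d)) :=
  hν.exists_law.choose

instance isProbabilityMeasure_law (hν : IsSymmLevyMeasure ν) : IsProbabilityMeasure hν.law :=
  hν.exists_law.choose_spec.1

theorem charFun_law (hν : IsSymmLevyMeasure ν) (ξ : EuclideanSpace ℝ (Fin d)) :
    charFun hν.law ξ = ((Real.exp (-levyExponent ν ξ) : ℝ) : ℂ) :=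
  hν.exists_law.choose_spec.2.1 ξ

theorem law_inner_gt_le (hν : IsSymmLevyMeasure ν) (h : EuclideanSpace ℝ (Fin d)) {B : ℝ}
    (hB : 0 ≤ B) (r : ℝ)
    (hcosh : ∫⁻ y, ENNReal.ofReal (Real.cosh (inner ℝ h y) - 1) ∂ν ≤ ENNReal.ofReal B) :
    hν.law {y | r < inner ℝ h y} ≤ ENNReal.ofReal (Real.exp (B - r)) :=
  hν.exists_law.choose_spec.2.2 h B r hB hcosh

end IsSymmLevyMeasure

theorem lintegral_Ioo_rpow {p : ℝ} (hp : -1 < p) {ρ : ℝ} (hρ : 0 < ρ) :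
    ∫⁻ t in Ioo 0 ρ, ENNReal.ofReal (t ^ p) = ENNReal.ofReal (ρ ^ (p + 1) / (p + 1)) := by
  have hint : IntegrableOn (fun t : ℝ => t ^ p) (Ioo 0 ρ) := by
    have := (intervalIntegral.intervalIntegrable_rpow' (a := 0) (b := ρ) hp)
    rw [intervalIntegrable_iff_integrableOn_Ioo_of_le hρ.le] at this
    exact this
  rw [← ofReal_integral_eq_lintegral_ofReal hint]
  · rw [← integral_Ioc_eq_integral_Ioo, ← intervalIntegral.integral_of_le hρ.le,
      integral_rpow (Or.inl hp), Real.zero_rpow (by linarith), sub_zero]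
  · filter_upwards [ae_restrict_mem measurableSet_Ioo] with t ht
    exact Real.rpow_nonneg ht.1.le _

/-- Layer-cake formula: the integral is at most `∫₀^ρ 2t · A t^(-α) dt`, finite because `α < 2`. -/
theorem lintegral_norm_sq_lt_le {α A : ℝ} (hα : α ∈ Ioo (0 : ℝ) 2) (hA : 0 ≤ A)
    (htail : ∀ ρ : ℝ, 0 < ρ → ν {y | ρ ≤ ‖y‖} ≤ ENNReal.ofReal (A * ρ ^ (-α)))
    {ρ : ℝ} (hρ : 0 < ρ) :
    ∫⁻ y in {y | ‖y‖ < ρ}, ENNReal.ofReal (‖y‖ ^ 2) ∂ν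
      ≤ ENNReal.ofReal (2 * A / (2 - α) * ρ ^ (2 - α)) := by
  have h := lintegral_comp_eq_lintegral_meas_le_mul (ν.restrict {y | ‖y‖ < ρ})
    (f := fun y : EuclideanSpace ℝ (Fin d) => ‖y‖) (g := fun t => 2 * t)
    (Eventually.of_forall fun y => norm_nonneg y) (by fun_prop)
    (fun t _ => Continuous.intervalIntegrable (by fun_prop) _ _)
    (by
      filter_upwards [ae_restrict_mem measurableSet_Ioi] with t ht
      have : 0 < t := ht
      positivity)
  have h2 (x : ℝ) : ∫ t in (0 : ℝ)..x, 2 * t = x ^ 2 := by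
    rw [intervalIntegral.integral_const_mul, integral_id]
    ring
  simp only [h2] at h
  rw [h]
  calc ∫⁻ t in Ioi 0, (ν.restrict {y | ‖y‖ < ρ}) {a | t ≤ ‖a‖} * ENNReal.ofReal (2 * t)
      ≤ ∫⁻ t in Ioi 0, (Ioo 0 ρ).indicator
          (fun t => ENNReal.ofReal (2 * A) * ENNReal.ofReal (t ^ (1 - α))) t := by
        refine setLIntegral_mono' measurableSet_Ioi fun t ht => ?_
        have ht : 0 < t := ht
        by_cases htρ : t < ρ
        · rw [indicator_of_mem (by exact ⟨ht, htρ⟩)]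
          calc _ ≤ ENNReal.ofReal (A * t ^ (-α)) * ENNReal.ofReal (2 * t) := by
                gcongr
                exact (Measure.restrict_apply_le _ _).trans (htail t ht)
            _ = _ := by
                rw [← ENNReal.ofReal_mul (by positivity), ← ENNReal.ofReal_mul (by positivity),
                  show 1 - α = -α + 1 by ring, Real.rpow_add_one ht.ne']
                ring_nf
        · have : (ν.restrict {y | ‖y‖ < ρ}) {a | t ≤ ‖a‖} = 0 := by
            rw [Measure.restrict_apply (measurableSet_le (by fun_prop) (by fun_prop))]
            convert measure_empty (μ := ν)
            ext y
            simp only [mem_inter_iff, mem_ofPred_eq, mem_empty_iff_false, iff_false, not_and]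
            intro h1 h2
            linarith
          rw [this, zero_mul]
          exact bot_le
    _ = ENNReal.ofReal (2 * A) * ∫⁻ t in Ioo 0 ρ, ENNReal.ofReal (t ^ (1 - α)) := by
        rw [lintegral_indicator measurableSet_Ioo, Measure.restrict_restrict measurableSet_Ioo,
          inter_eq_self_of_subset_left Ioo_subset_Ioi_self, lintegral_const_mul _ (by fun_prop)]
    _ = _ := by
        rw [lintegral_Ioo_rpow (by linarith [hα.2]) hρ, ← ENNReal.ofReal_mul (by positivity)]
        congr 1
        rw [show 1 - α + 1 = 2 - α by ring]
        ring

theorem norm_le_sum_abs (y : EuclideanSpace ℝ (Fin d)) : ‖y‖ ≤ ∑ i, |y i| := by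
  conv_lhs => rw [← (EuclideanSpace.basisFun (Fin d) ℝ).sum_repr y]
  refine (norm_sum_le _ _).trans (Finset.sum_le_sum fun i _ => ?_)
  simp [norm_smul]

theorem lintegral_cosh_sub_one_le {α A : ℝ} (hα : α ∈ Ioo (0 : ℝ) 2) (hA : 0 ≤ A)
    (htail : ∀ ρ : ℝ, 0 < ρ → ν {y | ρ ≤ ‖y‖} ≤ ENNReal.ofReal (A * ρ ^ (-α)))
    {s ρ : ℝ} (hρ : 0 < ρ) (hs : 0 < s) (h : EuclideanSpace ℝ (Fin d)) :
    ∫⁻ y, ENNReal.ofReal (Real.cosh (inner ℝ h y) - 1)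
        ∂(ENNReal.ofReal s • ν.restrict {y | ‖y‖ < ρ})
      ≤ ENNReal.ofReal
        (2 * A / (2 - α) * (s * ρ ^ (-α) * ((‖h‖ * ρ) ^ 2 * Real.exp (‖h‖ * ρ)))) := by
  have h2α : 0 < 2 - α := by linarith [hα.2]
  rw [lintegral_smul_measure, smul_eq_mul]
  calc ENNReal.ofReal s *
        ∫⁻ y in {y | ‖y‖ < ρ}, ENNReal.ofReal (Real.cosh (inner ℝ h y) - 1) ∂ν
      ≤ ENNReal.ofReal s * ∫⁻ y in {y | ‖y‖ < ρ},
          ENNReal.ofReal (‖h‖ ^ 2 * Real.exp (‖h‖ * ρ)) * ENNReal.ofReal (‖y‖ ^ 2) ∂ν := by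
        gcongr ENNReal.ofReal s * ?_
        refine setLIntegral_mono' (measurableSet_lt (by fun_prop) (by fun_prop)) fun y hy => ?_
        have hy : ‖y‖ < ρ := hy
        rw [← ENNReal.ofReal_mul (by positivity)]
        refine ENNReal.ofReal_le_ofReal ((cosh_sub_one_le _).trans ?_)
        have h1 := abs_real_inner_le_norm h y
        calc (inner ℝ h y) ^ 2 * Real.exp |inner ℝ h y|
            = |inner ℝ h y| ^ 2 * Real.exp |inner ℝ h y| := by rw [sq_abs]
          _ ≤ (‖h‖ * ‖y‖) ^ 2 * Real.exp (‖h‖ * ρ) := by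
              gcongr
              exact h1.trans (by gcongr)
          _ = _ := by ring
    _ ≤ ENNReal.ofReal s * (ENNReal.ofReal (‖h‖ ^ 2 * Real.exp (‖h‖ * ρ)) *
          ENNReal.ofReal (2 * A / (2 - α) * ρ ^ (2 - α))) := by
        rw [lintegral_const_mul _ (by fun_prop)]
        gcongr
        exact lintegral_norm_sq_lt_le hα hA htail hρ
    _ = _ := by
        rw [← ENNReal.ofReal_mul (by positivity), ← ENNReal.ofReal_mul (by positivity)]
        congr 1
        rw [show 2 - α = -α + 2 by ring, Real.rpow_add hρ, Real.rpow_two]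
        ring

/-- Tails of the law of the jumps smaller than `ρ` run up to a time below `ρ ^ α`. -/
theorem law_restrict_norm_ge_le {α A : ℝ} (hα : α ∈ Ioo (0 : ℝ) 2) (hA : 0 ≤ A) (hd : 0 < d)
    (hν : IsSymmLevyMeasure ν)
    (htail : ∀ ρ : ℝ, 0 < ρ → ν {y | ρ ≤ ‖y‖} ≤ ENNReal.ofReal (A * ρ ^ (-α)))
    {s ρ r : ℝ} (hρ : 0 < ρ) (hs : 0 < s) (hsρ : s ≤ ρ ^ α) (hr : 0 ≤ r) :
    ((hν.restrict_norm_lt ρ).smul s).law {y | r ≤ ‖y‖} ≤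
      ENNReal.ofReal (2 * d * Real.exp (4 * A / (2 - α)) * (s / ρ ^ α) ^ (r / (4 * d * ρ))) := by
  have h2α : 0 < 2 - α := by linarith [hα.2]
  have hd' : (0 : ℝ) < d := by exact_mod_cast hd
  have hd1 : (1 : ℝ) ≤ d := by exact_mod_cast hd
  have hρα : 0 < ρ ^ α := by positivity
  -- The covering by half-spaces below uses `r / 2 < r`, so `r = 0` is treated apart.
  rcases hr.eq_or_lt with rfl | hr
  · refine prob_le_one.trans ?_
    rw [← ENNReal.ofReal_one]
    refine ENNReal.ofReal_le_ofReal ?_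
    have : 1 ≤ Real.exp (4 * A / (2 - α)) := Real.one_le_exp (by positivity)
    simp only [zero_div, Real.rpow_zero, mul_one]
    nlinarith
  -- The Chernoff parameter is `v / ρ`. With `exp (2v) = ρ^α / s` and `v² ≤ 2 exp v`, the cumulant
  -- stays bounded, while the gain `exp (-v r / (2dρ))` is exactly the power of `s / ρ^α` claimed.
  set v := Real.log (ρ ^ α / s) / 2 with hv
  have hv0 : 0 ≤ v := div_nonneg (Real.log_nonneg (by rwa [one_le_div hs])) (by norm_num)
  have hexp : Real.exp v * Real.exp v = ρ ^ α / s := by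
    rw [← Real.exp_add, hv, add_halves, Real.exp_log (by positivity)]
  have hB : s * ρ ^ (-α) * (v ^ 2 * Real.exp v) ≤ 2 := by
    have h1 : v ^ 2 ≤ 2 * Real.exp v := by
      have := Real.quadratic_le_exp_of_nonneg hv0
      nlinarith
    calc s * ρ ^ (-α) * (v ^ 2 * Real.exp v) ≤ s * ρ ^ (-α) * (2 * Real.exp v * Real.exp v) := by
          gcongr
      _ = 2 := by
          rw [mul_assoc 2, hexp, Real.rpow_neg hρ.le]
          field_simp
  have key (e : EuclideanSpace ℝ (Fin d)) (he : ‖e‖ = 1) :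
      ((hν.restrict_norm_lt ρ).smul s).law {y | r / (2 * d) < inner ℝ e y} ≤
        ENNReal.ofReal (Real.exp (4 * A / (2 - α)) * (s / ρ ^ α) ^ (r / (4 * d * ρ))) := by
    have hnorm : ‖(v / ρ) • e‖ * ρ = v := by
      rw [norm_smul, he, Real.norm_of_nonneg (by positivity)]
      field_simp
    have h1 := lintegral_cosh_sub_one_le hα hA htail hρ hs ((v / ρ) • e)
    rw [hnorm] at h1
    have h2 := ((hν.restrict_norm_lt ρ).smul s).law_inner_gt_le ((v / ρ) • e)
      (B := 4 * A / (2 - α)) (by positivity) (v / ρ * (r / (2 * d))) (h1.trans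
        (ENNReal.ofReal_le_ofReal (by
          calc _ ≤ 2 * A / (2 - α) * 2 := by gcongr
            _ = _ := by ring)))
    rcases hv0.eq_or_lt with hv00 | hv00
    · refine prob_le_one.trans ?_
      have h3 : s / ρ ^ α = 1 := by
        rw [← hv00] at hexp
        rw [← inv_div, ← hexp]
        simp
      rw [h3, Real.one_rpow, mul_one, ← ENNReal.ofReal_one]
      exact ENNReal.ofReal_le_ofReal (Real.one_le_exp (by positivity))
    calc _ ≤ ((hν.restrict_norm_lt ρ).smul s).law
            {y | v / ρ * (r / (2 * d)) < inner ℝ ((v / ρ) • e) y} := by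
          refine measure_mono fun y hy => ?_
          have hy : r / (2 * d) < inner ℝ e y := hy
          change v / ρ * (r / (2 * d)) < inner ℝ ((v / ρ) • e) y
          rw [real_inner_smul_left]
          gcongr
      _ ≤ _ := h2
      _ = _ := by
          congr 1
          rw [sub_eq_add_neg, Real.exp_add]
          congr 1
          rw [Real.rpow_def_of_pos (by positivity), ← inv_div (ρ ^ α) s, Real.log_inv]
          congr 1
          rw [hv]
          field_simp
          ring
  -- If all coordinates were at most `r / (2d)` in absolute value, the norm would be at most `r /
  -- 2`.
  have hsub : {y : EuclideanSpace ℝ (Fin d) | r ≤ ‖y‖} ⊆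
      ⋃ i : Fin d, ({y | r / (2 * d) < inner ℝ (EuclideanSpace.single i (1 : ℝ)) y} ∪
        {y | r / (2 * d) < inner ℝ (-EuclideanSpace.single i (1 : ℝ)) y}) := by
    intro y hy
    have hy : r ≤ ‖y‖ := hy
    by_contra hcon
    simp only [mem_iUnion, mem_union, mem_ofPred_eq, not_exists, not_or, not_lt, inner_neg_left,
      EuclideanSpace.inner_single_left, map_one, one_mul] at hcon
    have h1 : ∑ i, |y i| ≤ ∑ _i : Fin d, r / (2 * d) := by
      refine Finset.sum_le_sum fun i _ => abs_le.2 ⟨?_, (hcon i).1⟩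
      linarith [(hcon i).2]
    rw [Finset.sum_const, Finset.card_univ, Fintype.card_fin, nsmul_eq_mul] at h1
    have h2 : (d : ℝ) * (r / (2 * d)) = r / 2 := by field_simp
    linarith [norm_le_sum_abs y]
  calc _ ≤ _ := measure_mono hsub
    _ ≤ ∑ i : Fin d, _ := measure_iUnion_fintype_le _ _
    _ ≤ ∑ _i : Fin d, 2 * ENNReal.ofReal
        (Real.exp (4 * A / (2 - α)) * (s / ρ ^ α) ^ (r / (4 * d * ρ))) := by
        refine Finset.sum_le_sum fun i _ => (measure_union_le _ _).trans ?_
        rw [two_mul (ENNReal.ofReal _)]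
        exact add_le_add (key (EuclideanSpace.single i 1) (by simp))
          (key (-EuclideanSpace.single i 1) (by simp))
    _ = _ := by
        rw [Finset.sum_const, Finset.card_univ, Fintype.card_fin, nsmul_eq_mul, ← mul_assoc,
          mul_assoc (2 * (d : ℝ)), ENNReal.ofReal_mul (p := 2 * (d : ℝ)) (by positivity),
          ENNReal.ofReal_mul (p := 2) (by norm_num), ENNReal.ofReal_natCast]
        norm_num [mul_comm]

end SmallJumps

/-! ### Mass of tails and small balls under the polar bound. -/

section Polar

variable {d : ℕ} {ν : Measure (EuclideanSpace ℝ (Fin d))} {α γ c : ℝ} {q : ℝ → ℝ}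
  {μ : Measure (Metric.sphere (0 : EuclideanSpace ℝ (Fin d)) 1)}

theorem norm_smul_sphere {s : ℝ} (hs : 0 < s)
    (θ : Metric.sphere (0 : EuclideanSpace ℝ (Fin d)) 1) :
    ‖s • (θ : EuclideanSpace ℝ (Fin d))‖ = s := by
  rw [norm_smul, norm_eq_of_mem_sphere, mul_one, Real.norm_of_nonneg hs.le]

theorem polarMass_norm_ge_le [IsFiniteMeasure μ] (hα : 0 < α) (hq_pos : ∀ s, 0 < s → 0 < q s)
    (hq_anti : AntitoneOn q (Ioi 0)) {ρ : ℝ} (hρ : 0 < ρ) :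
    polarMass α q μ {y | ρ ≤ ‖y‖} ≤ ENNReal.ofReal (μ.real univ / α * ρ ^ (-α) * q ρ) := by
  have hint : IntegrableOn (fun s : ℝ => s ^ (-1 - α)) (Ioi ρ) :=
    integrableOn_Ioi_rpow_of_lt (by linarith) hρ
  have hinner (θ : Metric.sphere (0 : EuclideanSpace ℝ (Fin d)) 1) :
      ∫⁻ s in Ioi (0 : ℝ), {y : EuclideanSpace ℝ (Fin d) | ρ ≤ ‖y‖}.indicator
        (fun _ => ENNReal.ofReal (s ^ (-1 - α) * q s)) (s • (θ : EuclideanSpace ℝ (Fin d)))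
      ≤ ENNReal.ofReal (ρ ^ (-α) / α * q ρ) := by
    calc _ ≤ ∫⁻ s in Ioi (0 : ℝ), (Ici ρ).indicator
          (fun s => ENNReal.ofReal (s ^ (-1 - α)) * ENNReal.ofReal (q ρ)) s := by
          refine setLIntegral_mono' measurableSet_Ioi fun s hs => ?_
          have hs : 0 < s := hs
          simp only [indicator, mem_ofPred_eq, norm_smul_sphere hs, mem_Ici]
          split_ifs with h
          · rw [← ENNReal.ofReal_mul (by positivity)]
            gcongr
            exact hq_anti hρ hs h
          · exact le_rfl
      _ = (∫⁻ s in Ioi ρ, ENNReal.ofReal (s ^ (-1 - α))) * ENNReal.ofReal (q ρ) := by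
          rw [lintegral_indicator measurableSet_Ici, Measure.restrict_restrict measurableSet_Ici,
            inter_eq_self_of_subset_left (Ici_subset_Ioi.2 hρ),
            lintegral_mul_const _ (by fun_prop), Measure.restrict_congr_set Ioi_ae_eq_Ici]
      _ = _ := by
          rw [← ofReal_integral_eq_lintegral_ofReal hint, integral_Ioi_rpow_of_lt (by linarith) hρ,
            ← ENNReal.ofReal_mul]
          · congr 2
            rw [show -1 - α + 1 = -α by ring, neg_div_neg_eq]
          · rw [show -1 - α + 1 = -α by ring, neg_div_neg_eq]
            positivity
          · filter_upwards [ae_restrict_mem measurableSet_Ioi] with s hs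
            exact Real.rpow_nonneg (hρ.trans hs).le _
  refine (lintegral_mono hinner).trans ?_
  rw [lintegral_const, ← ofReal_measureReal, ← ENNReal.ofReal_mul
    (by have := hq_pos ρ hρ; positivity)]
  refine ENNReal.ofReal_le_ofReal (le_of_eq ?_)
  ring

theorem norm_sub_lt_of_smul_mem_ball {w : EuclideanSpace ℝ (Fin d)} {r s : ℝ} (hw : w ≠ 0)
    (hs : 0 < s) (θ θ₀ : Metric.sphere (0 : EuclideanSpace ℝ (Fin d)) 1)
    (hθ₀ : ‖w‖ • (θ₀ : EuclideanSpace ℝ (Fin d)) = w)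
    (h : s • (θ : EuclideanSpace ℝ (Fin d)) ∈ Metric.ball w r) :
    θ ∈ Metric.ball θ₀ (2 * r / ‖w‖) ∧ s ∈ Ioo (‖w‖ - r) (‖w‖ + r) := by
  have hw' : 0 < ‖w‖ := norm_pos_iff.2 hw
  rw [mem_ball_iff_norm] at h
  have h1 : |s - ‖w‖| < r := by
    have := abs_norm_sub_norm_le (s • (θ : EuclideanSpace ℝ (Fin d))) w
    rw [norm_smul_sphere hs] at this
    exact this.trans_lt h
  have h1' := abs_lt.1 h1
  refine ⟨?_, ⟨by linarith [h1'.1], by linarith [h1'.2]⟩⟩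
  rw [Metric.mem_ball, Subtype.dist_eq, dist_eq_norm, lt_div_iff₀ hw']
  calc ‖(θ : EuclideanSpace ℝ (Fin d)) - θ₀‖ * ‖w‖
      = ‖‖w‖ • ((θ : EuclideanSpace ℝ (Fin d)) - θ₀)‖ := by
        rw [norm_smul, norm_norm, mul_comm]
    _ = ‖(‖w‖ - s) • (θ : EuclideanSpace ℝ (Fin d)) +
          (s • (θ : EuclideanSpace ℝ (Fin d)) - w)‖ := by
        congr 1
        rw [smul_sub, hθ₀, sub_smul]
        abel
    _ ≤ |s - ‖w‖| + ‖s • (θ : EuclideanSpace ℝ (Fin d)) - w‖ := by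
        refine (norm_add_le _ _).trans (add_le_add_left (le_of_eq ?_) _)
        rw [norm_smul, norm_eq_of_mem_sphere, mul_one, Real.norm_eq_abs, abs_sub_comm]
    _ < 2 * r := by linarith

/-- Seen from the origin, the ball lies in a radial interval of length `2r` times a cap of radius
`2r/‖w‖`, which contribute `r` and `r^(γ-1)`. The constraints on `r` and `w` keep the cap radius
below `1/2`. -/
theorem polarMass_ball_le (hγ : 1 ≤ γ) (hα : 0 < α) (hc : 0 < c)
    (hq_pos : ∀ s, 0 < s → 0 < q s) (hq_anti : AntitoneOn q (Ioi 0))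
    (hμ : ∀ (θ : Metric.sphere (0 : EuclideanSpace ℝ (Fin d)) 1) (r : ℝ), 0 < r → r < 1 / 2 →
      μ (Metric.ball θ r) ≤ ENNReal.ofReal (c * r ^ (γ - 1)))
    {w : EuclideanSpace ℝ (Fin d)} {r ρ : ℝ} (hr : 0 < r) (hρ : 0 < ρ) (hrρ : r ≤ ρ / 8)
    (hw : ρ * (7 / 8) ≤ ‖w‖) :
    polarMass α q μ (Metric.ball w r ∩ {y | ρ ≤ ‖y‖}) ≤
      ENNReal.ofReal (2 * c * 4 ^ (γ - 1) * r ^ γ * ρ ^ (-α - γ) * q ρ) := by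
  have hw' : 0 < ‖w‖ := by linarith
  have hw0 : w ≠ 0 := norm_pos_iff.1 hw'
  have hqρ := hq_pos ρ hρ
  let θ₀ : Metric.sphere (0 : EuclideanSpace ℝ (Fin d)) 1 :=
    ⟨‖w‖⁻¹ • w, by simp [norm_smul, hw'.ne']⟩
  have hθ₀ : ‖w‖ • (θ₀ : EuclideanSpace ℝ (Fin d)) = w := by
    simp [θ₀, smul_smul, hw'.ne']
  have hinner (θ : Metric.sphere (0 : EuclideanSpace ℝ (Fin d)) 1) :
      ∫⁻ s in Ioi (0 : ℝ), (Metric.ball w r ∩ {y : EuclideanSpace ℝ (Fin d) | ρ ≤ ‖y‖}).indicator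
        (fun _ => ENNReal.ofReal (s ^ (-1 - α) * q s)) (s • (θ : EuclideanSpace ℝ (Fin d)))
      ≤ (Metric.ball θ₀ (2 * r / ‖w‖)).indicator
        (fun _ => ENNReal.ofReal (ρ ^ (-1 - α) * q ρ * (2 * r))) θ := by
    by_cases hθ : θ ∈ Metric.ball θ₀ (2 * r / ‖w‖)
    · rw [indicator_of_mem hθ]
      calc _ ≤ ∫⁻ s in Ioi (0 : ℝ), (Ioo (‖w‖ - r) (‖w‖ + r)).indicator
            (fun _ => ENNReal.ofReal (ρ ^ (-1 - α) * q ρ)) s := by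
            refine setLIntegral_mono' measurableSet_Ioi fun s hs => ?_
            have hs : 0 < s := hs
            by_cases hm : s • (θ : EuclideanSpace ℝ (Fin d)) ∈
                Metric.ball w r ∩ {y : EuclideanSpace ℝ (Fin d) | ρ ≤ ‖y‖}
            · rw [indicator_of_mem hm,
                indicator_of_mem (norm_sub_lt_of_smul_mem_ball hw0 hs θ θ₀ hθ₀ hm.1).2]
              have hρs : ρ ≤ s := by
                have := hm.2
                rwa [mem_ofPred_eq, norm_smul_sphere hs] at this
              refine ENNReal.ofReal_le_ofReal (mul_le_mul ?_ (hq_anti hρ hs hρs)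
                (hq_pos s hs).le (by positivity))
              exact Real.rpow_le_rpow_of_nonpos hρ hρs (by linarith)
            · rw [indicator_of_notMem hm]
              exact bot_le
        _ ≤ ∫⁻ s, (Ioo (‖w‖ - r) (‖w‖ + r)).indicator
            (fun _ => ENNReal.ofReal (ρ ^ (-1 - α) * q ρ)) s := setLIntegral_le_lintegral _ _
        _ = _ := by
            rw [lintegral_indicator_const measurableSet_Ioo, Real.volume_Ioo,
              ← ENNReal.ofReal_mul (by positivity)]
            congr 2
            ring
    · rw [indicator_of_notMem hθ]
      refine le_of_eq (setLIntegral_eq_zero measurableSet_Ioi fun s hs => ?_)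
      exact indicator_of_notMem (fun hm => hθ
        (norm_sub_lt_of_smul_mem_ball hw0 hs θ θ₀ hθ₀ hm.1).1) _
  have hsmall : 2 * r / ‖w‖ < 1 / 2 := by
    rw [div_lt_iff₀ hw']
    linarith
  calc polarMass α q μ (Metric.ball w r ∩ {y | ρ ≤ ‖y‖})
      ≤ ∫⁻ θ, (Metric.ball θ₀ (2 * r / ‖w‖)).indicator
        (fun _ => ENNReal.ofReal (ρ ^ (-1 - α) * q ρ * (2 * r))) θ ∂μ := lintegral_mono hinner
    _ ≤ ENNReal.ofReal (ρ ^ (-1 - α) * q ρ * (2 * r)) *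
          ENNReal.ofReal (c * (2 * r / ‖w‖) ^ (γ - 1)) := by
        rw [lintegral_indicator_const Metric.isOpen_ball.measurableSet]
        gcongr
        exact hμ θ₀ _ (by positivity) hsmall
    _ ≤ ENNReal.ofReal (ρ ^ (-1 - α) * q ρ * (2 * r)) *
          ENNReal.ofReal (c * (4 * (r / ρ)) ^ (γ - 1)) := by
        gcongr ENNReal.ofReal _ * ENNReal.ofReal (c * ?_)
        refine Real.rpow_le_rpow (by positivity) ?_ (by linarith)
        rw [div_le_iff₀ hw']
        have : 4 * (r / ρ) * (ρ * (7 / 8)) ≤ 4 * (r / ρ) * ‖w‖ := by gcongr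
        have h2 : 4 * (r / ρ) * (ρ * (7 / 8)) = 7 / 2 * r := by field_simp; ring
        linarith
    _ = _ := by
        rw [← ENNReal.ofReal_mul (by positivity)]
        congr 1
        rw [Real.mul_rpow (by norm_num) (by positivity), Real.div_rpow hr.le hρ.le,
          show -α - γ = (-1 - α) - (γ - 1) by ring, Real.rpow_sub hρ (-1 - α),
          Real.rpow_sub_one hr.ne']
        field_simp

/-- Uniform small-ball estimate for the part of `ν` away from the origin. -/
theorem measure_ball_inter_norm_ge_le [IsFiniteMeasure μ] (hγ : 1 ≤ γ) (hα : 0 < α) (hc : 0 < c)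
    (hq_pos : ∀ s, 0 < s → 0 < q s) (hq_anti : AntitoneOn q (Ioi 0))
    (hμ : ∀ (θ : Metric.sphere (0 : EuclideanSpace ℝ (Fin d)) 1) (r : ℝ), 0 < r → r < 1 / 2 →
      μ (Metric.ball θ r) ≤ ENNReal.ofReal (c * r ^ (γ - 1)))
    (hν : ∀ A : Set (EuclideanSpace ℝ (Fin d)), MeasurableSet A → ν A ≤ polarMass α q μ A)
    (w : EuclideanSpace ℝ (Fin d)) {r ρ : ℝ} (hr : 0 < r) (hρ : 0 < ρ) :
    ν (Metric.ball w r ∩ {y | ρ ≤ ‖y‖}) ≤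
      ENNReal.ofReal ((2 * c * 4 ^ (γ - 1) + μ.real univ / α * 8 ^ γ) *
        r ^ γ * ρ ^ (-α - γ) * q ρ) := by
  have hqρ := hq_pos ρ hρ
  have hmeas : MeasurableSet {y : EuclideanSpace ℝ (Fin d) | ρ ≤ ‖y‖} :=
    measurableSet_le (by fun_prop) (by fun_prop)
  rcases le_total r (ρ / 8) with hrρ | hrρ
  · rcases le_total (ρ * (7 / 8)) ‖w‖ with hw | hw
    · refine (hν _ (Metric.isOpen_ball.measurableSet.inter hmeas)).trans
        ((polarMass_ball_le hγ hα hc hq_pos hq_anti hμ hr hρ hrρ hw).trans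
          (ENNReal.ofReal_le_ofReal ?_))
      gcongr
      have : 0 ≤ μ.real univ / α * 8 ^ γ := by positivity
      linarith
    · have hempty : Metric.ball w r ∩ {y : EuclideanSpace ℝ (Fin d) | ρ ≤ ‖y‖} = ∅ := by
        ext y
        simp only [mem_inter_iff, mem_ball_iff_norm, mem_ofPred_eq, mem_empty_iff_false, iff_false,
          not_and, not_le]
        intro hy
        have := norm_le_norm_add_norm_sub' y w
        linarith
      rw [hempty, measure_empty]
      exact bot_le
  -- For `r ≥ ρ/8` the whole tail is small enough, as `8^γ (r/ρ)^γ ≥ 1`.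
  · refine (measure_mono inter_subset_right).trans ((hν _ hmeas).trans
      ((polarMass_norm_ge_le hα hq_pos hq_anti hρ).trans (ENNReal.ofReal_le_ofReal ?_)))
    calc μ.real univ / α * ρ ^ (-α) * q ρ
        = μ.real univ / α * 8 ^ γ * (ρ / 8) ^ γ * ρ ^ (-α - γ) * q ρ := by
          rw [Real.div_rpow hρ.le (by norm_num), Real.rpow_sub hρ]
          field_simp
      _ ≤ (2 * c * 4 ^ (γ - 1) + μ.real univ / α * 8 ^ γ) * r ^ γ * ρ ^ (-α - γ) * q ρ := by
          gcongr
          have : 0 ≤ 2 * c * (4 : ℝ) ^ (γ - 1) := by positivity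
          linarith

end Polar

/-! ### Decay of characteristic functions. -/

section CharFunDecay

variable {d : ℕ} {ν : Measure (EuclideanSpace ℝ (Fin d))}

theorem integrable_norm_pow_mul_exp_neg_rpow (hd : 0 < d) {α a : ℝ} (hα : 0 < α) (ha : 0 < a)
    (n : ℕ) :
    Integrable fun ξ : EuclideanSpace ℝ (Fin d) => ‖ξ‖ ^ n * Real.exp (-a * ‖ξ‖ ^ α) := by
  have : Nontrivial (EuclideanSpace ℝ (Fin d)) := by
    have : Nonempty (Fin d) := ⟨⟨0, hd⟩⟩
    infer_instance
  refine (integrable_fun_norm_addHaar volume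
    (f := fun x : ℝ => x ^ n * Real.exp (-a * x ^ α))).2 ?_
  have h := integrableOn_rpow_mul_exp_neg_mul_rpow (p := α) (s := ((d - 1 + n : ℕ) : ℝ)) (b := a)
    (by have : (0 : ℝ) ≤ ((d - 1 + n : ℕ) : ℝ) := Nat.cast_nonneg _
        linarith) hα ha
  refine h.congr_fun (fun x _ => ?_) measurableSet_Ioi
  simp only [finrank_euclideanSpace, Fintype.card_fin, smul_eq_mul, Real.rpow_natCast, pow_add]
  ring

theorem integral_exp_neg_mul_rpow_norm {α c s : ℝ} (hα : 0 < α) (hs : 0 < s) :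
    ∫ ξ : EuclideanSpace ℝ (Fin d), Real.exp (-(c * s) * ‖ξ‖ ^ α)
      = s ^ (-(d : ℝ) / α) * ∫ ξ : EuclideanSpace ℝ (Fin d), Real.exp (-c * ‖ξ‖ ^ α) := by
  have h := Measure.integral_comp_smul (volume : Measure (EuclideanSpace ℝ (Fin d)))
    (fun ξ => Real.exp (-c * ‖ξ‖ ^ α)) (s ^ (1 / α))
  have h1 (ξ : EuclideanSpace ℝ (Fin d)) : ‖s ^ (1 / α) • ξ‖ ^ α = s * ‖ξ‖ ^ α := by
    rw [norm_smul, Real.norm_of_nonneg (by positivity), Real.mul_rpow (by positivity)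
      (norm_nonneg _), ← Real.rpow_mul hs.le, one_div_mul_cancel hα.ne', Real.rpow_one]
  have h2 : |((s ^ (1 / α)) ^ d)⁻¹| = s ^ (-(d : ℝ) / α) := by
    rw [abs_of_nonneg (by positivity), ← Real.rpow_natCast, ← Real.rpow_mul hs.le,
      ← Real.rpow_neg hs.le]
    congr 1
    ring
  simp only [h1, finrank_euclideanSpace, Fintype.card_fin, h2, smul_eq_mul] at h
  rw [← h]
  refine integral_congr_ae (Eventually.of_forall fun ξ => ?_)
  simp only
  congr 1
  ring

theorem levyExponent_nonneg (ξ : EuclideanSpace ℝ (Fin d)) : 0 ≤ levyExponent ν ξ :=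
  integral_nonneg fun _ => one_sub_cos_nonneg _

theorem levyExponent_smul {s : ℝ} (hs : 0 ≤ s) (ξ : EuclideanSpace ℝ (Fin d)) :
    levyExponent (ENNReal.ofReal s • ν) ξ = s * levyExponent ν ξ := by
  rw [levyExponent, integral_smul_measure, ENNReal.toReal_ofReal hs, smul_eq_mul, levyExponent]

theorem compl_norm_lt (ρ : ℝ) :
    {y : EuclideanSpace ℝ (Fin d) | ‖y‖ < ρ}ᶜ = {y | ρ ≤ ‖y‖} := by
  ext y
  simp

theorem IsSymmLevyMeasure.levyExponent_add (hν : IsSymmLevyMeasure ν) (ρ : ℝ)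
    (ξ : EuclideanSpace ℝ (Fin d)) :
    levyExponent (ν.restrict {y | ‖y‖ < ρ}) ξ + levyExponent (ν.restrict {y | ρ ≤ ‖y‖}) ξ
      = levyExponent ν ξ := by
  rw [← compl_norm_lt]
  exact integral_add_compl (measurableSet_lt (by fun_prop) (by fun_prop))
    (hν.integrable_one_sub_cos ξ)

theorem IsSymmLevyMeasure.levyExponent_restrict_norm_ge_le (hν : IsSymmLevyMeasure ν) {α A : ℝ}
    (hA : 0 ≤ A)
    (htail : ∀ ρ : ℝ, 0 < ρ → ν {y | ρ ≤ ‖y‖} ≤ ENNReal.ofReal (A * ρ ^ (-α)))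
    {ρ : ℝ} (hρ : 0 < ρ) (ξ : EuclideanSpace ℝ (Fin d)) :
    levyExponent (ν.restrict {y | ρ ≤ ‖y‖}) ξ ≤ 2 * (A * ρ ^ (-α)) := by
  have := hν.isFiniteMeasure_restrict hρ
  calc levyExponent (ν.restrict {y | ρ ≤ ‖y‖}) ξ
      ≤ ∫ y in {y | ρ ≤ ‖y‖}, (2 : ℝ) ∂ν := by
        refine integral_mono (hν.integrable_one_sub_cos ξ).integrableOn (integrable_const _)
          fun y => ?_
        simp only
        linarith [Real.neg_one_le_cos (inner ℝ ξ y)]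
    _ = 2 * ν.real {y | ρ ≤ ‖y‖} := by simp [mul_comm]
    _ ≤ _ := by
        gcongr
        exact ENNReal.toReal_le_of_le_ofReal (by positivity) (htail ρ hρ)

/-- The factor `exp (c₀ s)` pays for `x ≤ 1`, where no lower bound on `Φ` is available. -/
theorem exp_neg_le_of_lower_bound {α c₀ s Φ b x : ℝ} (hα : 0 < α) (hc₀ : 0 < c₀) (hs : 0 < s)
    (hx : 0 ≤ x) (hΦ : 0 ≤ Φ) (hb : 0 ≤ b) (hlow : 1 < x → c₀ * x ^ α - b ≤ Φ) :
    Real.exp (-(s * Φ)) ≤ Real.exp (s * b + c₀ * s) * Real.exp (-(c₀ * s) * x ^ α) := by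
  rw [← Real.exp_add, Real.exp_le_exp]
  rcases le_or_gt x 1 with h | h
  · have h1 : x ^ α ≤ 1 := Real.rpow_le_one hx h hα.le
    have h2 : c₀ * s * x ^ α ≤ c₀ * s * 1 := by gcongr
    nlinarith [mul_nonneg hs.le hΦ, mul_nonneg hs.le hb]
  · have := mul_le_mul_of_nonneg_left (hlow h) hs.le
    nlinarith [mul_pos hc₀ hs]

/-- Deleting the jumps above `ρ` lowers the exponent by at most `2Aρ^(-α)`, which up to time `s ≤
ρ^α` costs only a constant factor. -/
theorem norm_charFun_law_restrict_le (hν : IsSymmLevyMeasure ν) {α A c₀ : ℝ} (hα : 0 < α)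
    (hA : 0 ≤ A) (hc₀ : 0 < c₀)
    (htail : ∀ ρ : ℝ, 0 < ρ → ν {y | ρ ≤ ‖y‖} ≤ ENNReal.ofReal (A * ρ ^ (-α)))
    (hlow : ∀ ξ : EuclideanSpace ℝ (Fin d), 1 < ‖ξ‖ → c₀ * ‖ξ‖ ^ α ≤ levyExponent ν ξ)
    {s ρ : ℝ} (hs : 0 < s) (hs1 : s ≤ 1) (hρ : 0 < ρ) (hsρ : s ≤ ρ ^ α)
    (ξ : EuclideanSpace ℝ (Fin d)) :
    ‖charFun ((hν.restrict_norm_lt ρ).smul s).law ξ‖ ≤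
      Real.exp (2 * A + c₀) * Real.exp (-(c₀ * s) * ‖ξ‖ ^ α) := by
  rw [IsSymmLevyMeasure.charFun_law, levyExponent_smul hs.le, Complex.norm_real,
    Real.norm_of_nonneg (Real.exp_nonneg _)]
  have h1 := exp_neg_le_of_lower_bound (b := 2 * (A * ρ ^ (-α))) hα hc₀ hs (norm_nonneg ξ)
    (levyExponent_nonneg (ν := ν.restrict {y | ‖y‖ < ρ}) ξ) (by positivity) (fun hξ => by
      have h2 := hν.levyExponent_add ρ ξ
      have h3 := hν.levyExponent_restrict_norm_ge_le hA htail hρ ξ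
      have h4 := hlow ξ hξ
      linarith)
  refine h1.trans (mul_le_mul_of_nonneg_right (Real.exp_le_exp.2 ?_) (Real.exp_nonneg _))
  have h5 : s * ρ ^ (-α) ≤ 1 := by
    rw [Real.rpow_neg hρ.le, ← div_eq_mul_inv]
    exact div_le_one_of_le₀ hsρ (by positivity)
  have h6 : A * (s * ρ ^ (-α)) ≤ A * 1 := mul_le_mul_of_nonneg_left h5 hA
  have h7 : c₀ * s ≤ c₀ * 1 := by gcongr
  linarith

theorem integrable_charFun_of_le (hd : 0 < d) {Q : Measure (EuclideanSpace ℝ (Fin d))}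
    [IsFiniteMeasure Q] {α a C : ℝ} (hα : 0 < α) (ha : 0 < a)
    (h : ∀ ξ, ‖charFun Q ξ‖ ≤ C * Real.exp (-a * ‖ξ‖ ^ α)) (n : ℕ) :
    Integrable fun ξ => ‖ξ‖ ^ n * ‖charFun Q ξ‖ := by
  refine ((integrable_norm_pow_mul_exp_neg_rpow hd hα ha n).const_mul C).mono' (by fun_prop)
    (Eventually.of_forall fun ξ => ?_)
  rw [Real.norm_of_nonneg (by positivity)]
  calc ‖ξ‖ ^ n * ‖charFun Q ξ‖ ≤ ‖ξ‖ ^ n * (C * Real.exp (-a * ‖ξ‖ ^ α)) := by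
        gcongr
        exact h ξ
    _ = _ := by ring

theorem integrable_charFun_of_le' (hd : 0 < d) {Q : Measure (EuclideanSpace ℝ (Fin d))}
    [IsFiniteMeasure Q] {α a C : ℝ} (hα : 0 < α) (ha : 0 < a)
    (h : ∀ ξ, ‖charFun Q ξ‖ ≤ C * Real.exp (-a * ‖ξ‖ ^ α)) : Integrable (charFun Q) := by
  have := integrable_charFun_of_le hd hα ha h 0
  simp only [pow_zero, one_mul] at this
  exact (integrable_norm_iff (by fun_prop)).1 this

theorem integral_norm_charFun_le (hd : 0 < d) {Q : Measure (EuclideanSpace ℝ (Fin d))}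
    [IsFiniteMeasure Q] {α c s C : ℝ} (hα : 0 < α) (hc : 0 < c) (hs : 0 < s)
    (h : ∀ ξ, ‖charFun Q ξ‖ ≤ C * Real.exp (-(c * s) * ‖ξ‖ ^ α)) :
    ∫ ξ, ‖charFun Q ξ‖ ≤ C * (∫ ξ : EuclideanSpace ℝ (Fin d), Real.exp (-c * ‖ξ‖ ^ α)) *
      s ^ (-(d : ℝ) / α) := by
  have hint := integrable_norm_pow_mul_exp_neg_rpow hd hα (mul_pos hc hs) 0
  simp only [pow_zero, one_mul] at hint
  calc ∫ ξ, ‖charFun Q ξ‖ ≤ ∫ ξ, C * Real.exp (-(c * s) * ‖ξ‖ ^ α) :=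
        integral_mono (integrable_charFun_of_le' hd hα (mul_pos hc hs) h).norm
          (hint.const_mul C) h
    _ = _ := by
        rw [integral_const_mul, integral_exp_neg_mul_rpow_norm hα hs]
        ring

end CharFunDecay

/-! ### Density bounds for convolutions. -/

section ConvolutionBounds

open Measure

theorem le_of_withDensity_le {E : Type*} [TopologicalSpace E] [MeasurableSpace E] [BorelSpace E]
    {V : Measure E} [V.IsOpenPosMeasure] [IsLocallyFiniteMeasure V]
    {f : E → ℝ} (hf : Continuous f) {x : E} {U : Set E} (hU : IsOpen U) (hx : x ∈ U) {N : ℝ}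
    (h : ∀ A, MeasurableSet A → A ⊆ U →
      (V.withDensity fun y => ENNReal.ofReal (f y)) A ≤ ENNReal.ofReal N * V A) (hN : 0 ≤ N) :
    f x ≤ N := by
  by_contra! hlt
  obtain ⟨c, hc1, hc2⟩ := exists_between hlt
  have hopen : IsOpen (U ∩ {y | c < f y}) := hU.inter (isOpen_lt continuous_const hf)
  obtain ⟨W, hxW, hWo, hWf⟩ := exists_isOpen_measure_lt_top V x
  set S := (U ∩ {y | c < f y}) ∩ W with hS
  have hSo : IsOpen S := hopen.inter hWo
  have hpos : 0 < V S := hSo.measure_pos V ⟨x, ⟨hx, hc2⟩, hxW⟩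
  have hfin : V S < ⊤ := (measure_mono inter_subset_right).trans_lt hWf
  have h1 := h S hSo.measurableSet fun y hy => hy.1.1
  rw [withDensity_apply _ hSo.measurableSet] at h1
  have h2 : ENNReal.ofReal c * V S ≤ ∫⁻ y in S, ENNReal.ofReal (f y) ∂V := by
    rw [← setLIntegral_const]
    refine setLIntegral_mono' hSo.measurableSet fun y hy => ENNReal.ofReal_le_ofReal ?_
    exact le_of_lt hy.1.2
  have h3 := (ENNReal.mul_le_mul_iff_left hpos.ne' hfin.ne).1 (h2.trans h1)
  rw [ENNReal.ofReal_le_ofReal_iff hN] at h3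
  linarith

variable {E : Type*} [NormedAddCommGroup E] [MeasurableSpace E] [BorelSpace E]
  [SecondCountableTopology E]

theorem conv_le_smul (m P V : Measure E) [SFinite P] [V.IsAddLeftInvariant] {M : ENNReal}
    (hP : P ≤ M • V) : m ∗ P ≤ (m univ * M) • V := by
  refine Measure.le_iff.2 fun A hA => ?_
  rw [conv_apply _ _ hA]
  calc ∫⁻ x, P ((fun y => x + y) ⁻¹' A) ∂m ≤ ∫⁻ _, M * V A ∂m := by
        refine lintegral_mono fun x => (hP _).trans_eq ?_
        rw [Measure.smul_apply, measure_preimage_add, smul_eq_mul]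
    _ = _ := by
        rw [lintegral_const, Measure.smul_apply, smul_eq_mul]
        ring

/-- A sum of norm at least `r` has a summand of norm at least `r/2`; that summand supplies the tail
probability, the other one the bounded density. -/
theorem conv_self_apply_le (Q V : Measure E) [IsFiniteMeasure Q] [V.IsAddLeftInvariant]
    {M p : ENNReal} (hQ : Q ≤ M • V) {r : ℝ} (htail : Q {y | r / 2 ≤ ‖y‖} ≤ p)
    {A : Set E} (hA : MeasurableSet A) (hAr : A ⊆ {y | r ≤ ‖y‖}) :
    (Q ∗ Q) A ≤ 2 * (p * M) * V A := by
  set T : Set E := {y | r / 2 ≤ ‖y‖} with hT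
  have hTm : MeasurableSet T := measurableSet_le (by fun_prop) (by fun_prop)
  have hsplit : Q = Q.restrict T + Q.restrict Tᶜ := (restrict_add_restrict_compl hTm).symm
  have h1 : Q ∗ Q = Q.restrict T ∗ Q + (Q.restrict Tᶜ ∗ Q.restrict T +
      Q.restrict Tᶜ ∗ Q.restrict Tᶜ) := by
    rw [← conv_add, ← hsplit, ← add_conv, ← hsplit]
  have h2 : (Q.restrict Tᶜ ∗ Q.restrict Tᶜ) A = 0 := by
    rw [conv_apply _ _ hA]
    refine setLIntegral_eq_zero hTm.compl fun x hx => ?_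
    simp only [Pi.zero_apply]
    rw [restrict_apply (measurable_const_add x hA)]
    convert measure_empty (μ := Q)
    ext y
    simp only [mem_inter_iff, mem_preimage, mem_empty_iff_false, iff_false, not_and]
    intro hxy hy
    have h3 : r ≤ ‖x + y‖ := hAr hxy
    have h4 : ¬ r / 2 ≤ ‖x‖ := hx
    have h5 : ¬ r / 2 ≤ ‖y‖ := hy
    linarith [norm_add_le x y]
  have h3 : (Q.restrict T ∗ Q) A ≤ p * M * V A := by
    refine (conv_le_smul (Q.restrict T) Q V hQ A).trans ?_
    rw [Measure.smul_apply, restrict_apply_univ, smul_eq_mul]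
    gcongr
  have h4 : (Q.restrict Tᶜ ∗ Q.restrict T) A ≤ p * M * V A := by
    rw [conv_comm]
    exact (conv_mono_right _ restrict_le_self A).trans h3
  rw [h1, Measure.add_apply, Measure.add_apply, h2, add_zero]
  calc _ ≤ p * M * V A + p * M * V A := add_le_add h3 h4
    _ = _ := by ring

/-- Cut `Q` into annuli of width `ε`. On the `k`-th one its density is at most `D k`, and Tonelli
converts the remaining integral of `V (A ∩ ball x _)` over `l` into the `l`-mass of balls centred in
`A`. -/
theorem conv_le_of_annulus_bounds (Q l V : Measure E) [IsFiniteMeasure Q] [IsFiniteMeasure l]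
    [SFinite V] [V.IsAddLeftInvariant] {ε : ℝ} (hε : 0 < ε) {D b : ℕ → ENNReal}
    (hQ : ∀ (k : ℕ) (A : Set E), MeasurableSet A → A ⊆ {y | k * ε ≤ ‖y‖} → Q A ≤ D k * V A)
    (hl : ∀ (k : ℕ) (w : E), l (Metric.ball w ((k + 1) * ε)) ≤ b k) :
    Q ∗ l ≤ (∑' k, D k * b k) • V := by
  refine Measure.le_iff.2 fun A hA => ?_
  let R (k : ℕ) : Set E := {z | k * ε ≤ ‖z‖} ∩ {z | ‖z‖ < (k + 1) * ε}
  have hRm (k : ℕ) : MeasurableSet (R k) :=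
    (measurableSet_le (by fun_prop) (by fun_prop)).inter
      (measurableSet_lt (by fun_prop) (by fun_prop))
  have hcover : (⋃ k, R k) = univ := by
    refine eq_univ_of_forall fun z => mem_iUnion.2 ⟨⌊‖z‖ / ε⌋₊, ?_, ?_⟩
    · rw [mem_ofPred_eq, ← le_div_iff₀ hε]
      exact Nat.floor_le (by positivity)
    · rw [mem_ofPred_eq, ← div_lt_iff₀ hε]
      exact Nat.lt_floor_add_one _
  have hpt (x : E) : Q ((fun y => x + y) ⁻¹' A) ≤
      ∑' k : ℕ, D k * V (A ∩ Metric.ball x ((k + 1) * ε)) := by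
    have hAx : MeasurableSet ((fun y => x + y) ⁻¹' A) := measurable_const_add x hA
    calc Q ((fun y => x + y) ⁻¹' A) = Q (⋃ k, (fun y => x + y) ⁻¹' A ∩ R k) := by
          rw [← inter_iUnion, hcover, inter_univ]
      _ ≤ ∑' k, Q ((fun y => x + y) ⁻¹' A ∩ R k) := measure_iUnion_le _
      _ ≤ _ := by
          refine ENNReal.tsum_le_tsum fun k => (hQ k _ (hAx.inter (hRm k))
            (fun z hz => hz.2.1)).trans (mul_le_mul_right ?_ _)
          rw [← measure_preimage_add V x (A ∩ Metric.ball x ((k + 1) * ε))]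
          refine measure_mono fun z hz => ⟨hz.1, ?_⟩
          rw [mem_ball_iff_norm, add_sub_cancel_left]
          exact hz.2.2
  have hswap (k : ℕ) : ∫⁻ x, V (A ∩ Metric.ball x ((k + 1) * ε)) ∂l ≤ b k * V A := by
    have hm : MeasurableSet (Prod.snd ⁻¹' A ∩ {p : E × E | dist p.2 p.1 < (k + 1) * ε}) :=
      (measurable_snd hA).inter (measurableSet_lt (by fun_prop) (by fun_prop))
    have h1 := prod_apply (μ := l) (ν := V) hm
    have h2 := prod_apply_symm (μ := l) (ν := V) hm
    calc ∫⁻ x, V (A ∩ Metric.ball x ((k + 1) * ε)) ∂l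
        = ∫⁻ y, l ((fun x => (x, y)) ⁻¹' (Prod.snd ⁻¹' A ∩ {p : E × E | dist p.2 p.1 < (k + 1) * ε})) ∂V :=
          h1.symm.trans h2
      _ ≤ ∫⁻ y, A.indicator (fun _ => b k) y ∂V := by
          refine lintegral_mono fun y => ?_
          by_cases hy : y ∈ A
          · rw [indicator_of_mem hy]
            refine (measure_mono fun x hx => ?_).trans (hl k y)
            rw [Metric.mem_ball, dist_comm]
            exact hx.2
          · rw [indicator_of_notMem hy]
            refine le_of_eq ?_
            convert measure_empty (μ := l)
            ext x
            simp [hy]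
      _ = b k * V A := lintegral_indicator_const hA _
  have hmeas (k : ℕ) : Measurable fun x => V (A ∩ Metric.ball x ((k + 1) * ε)) := by
    have hm : MeasurableSet (Prod.snd ⁻¹' A ∩ {p : E × E | dist p.2 p.1 < (k + 1) * ε}) :=
      (measurable_snd hA).inter (measurableSet_lt (by fun_prop) (by fun_prop))
    exact measurable_measure_prodMk_left hm
  rw [conv_comm, conv_apply _ _ hA]
  calc _ ≤ ∫⁻ x, ∑' k : ℕ, D k * V (A ∩ Metric.ball x ((k + 1) * ε)) ∂l := lintegral_mono hpt
    _ = ∑' k : ℕ, D k * ∫⁻ x, V (A ∩ Metric.ball x ((k + 1) * ε)) ∂l := by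
        rw [lintegral_tsum fun k => ((hmeas k).const_mul _).aemeasurable]
        exact tsum_congr fun k => lintegral_const_mul _ (hmeas k)
    _ ≤ ∑' k : ℕ, D k * (b k * V A) := by
        gcongr with k
        exact hswap k
    _ = _ := by
        rw [Measure.smul_apply, smul_eq_mul, ← ENNReal.tsum_mul_right]
        exact tsum_congr fun k => by ring

end ConvolutionBounds

/-! ### Decomposition of the law by jump size. -/

section LawBounds

variable {d : ℕ} {ν : Measure (EuclideanSpace ℝ (Fin d))}

namespace IsSymmLevyMeasure

theorem eq_law (hν : IsSymmLevyMeasure ν) {Q : Measure (EuclideanSpace ℝ (Fin d))}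
    [IsFiniteMeasure Q]
    (h : ∀ ξ, charFun Q ξ = ((Real.exp (-levyExponent ν ξ) : ℝ) : ℂ)) : Q = hν.law :=
  Measure.ext_of_charFun (funext fun ξ => (h ξ).trans (hν.charFun_law ξ).symm)

theorem charFun_law_smul (hν : IsSymmLevyMeasure ν) {t : ℝ} (ht : 0 ≤ t)
    (ξ : EuclideanSpace ℝ (Fin d)) :
    charFun (hν.smul t).law ξ = ((Real.exp (-(t * levyExponent ν ξ)) : ℝ) : ℂ) := by
  rw [charFun_law, levyExponent_smul ht]

theorem law_smul_add (hν : IsSymmLevyMeasure ν) {s t : ℝ} (hs : 0 ≤ s) (ht : 0 ≤ t) :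
    (hν.smul (s + t)).law = (hν.smul s).law.conv (hν.smul t).law := by
  refine ((hν.smul (s + t)).eq_law fun ξ => ?_).symm
  rw [charFun_conv, hν.charFun_law_smul hs, hν.charFun_law_smul ht,
    levyExponent_smul (add_nonneg hs ht), ← Complex.ofReal_mul, ← Real.exp_add]
  congr 2
  ring

theorem isLevySemigroup_law (hν : IsSymmLevyMeasure ν) :
    IsLevySemigroup ν fun t => (hν.smul t).law where
  prob _ _ := inferInstance
  conv _ _ hs ht := hν.law_smul_add hs ht
  charFun_eq _ ht ξ := hν.charFun_law_smul ht ξ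

theorem charFun_compoundPoisson [IsFiniteMeasure ν] (hν : IsSymmLevyMeasure ν)
    (ξ : EuclideanSpace ℝ (Fin d)) :
    charFun (compoundPoisson ν) ξ = ((Real.exp (-levyExponent ν ξ) : ℝ) : ℂ) := by
  rw [_root_.charFun_compoundPoisson, hν.charFun_eq]
  push_cast
  ring_nf

/-- Splitting off the jumps larger than `ρ`: the remaining part of the law is dominated by the
convolution of the small-jump law with the jump measure. -/
theorem le_law_add_smul (hν : IsSymmLevyMeasure ν) {P V : Measure (EuclideanSpace ℝ (Fin d))}
    [IsFiniteMeasure P] [V.IsAddLeftInvariant] {t ε ρ : ℝ} (ht : 0 ≤ t) (hερ : ε ≤ ρ)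
    (hρ : 0 < ρ)
    (hP : ∀ ξ, charFun P ξ = ((Real.exp (-(t * levyExponent ν ξ)) : ℝ) : ℂ)) {M : ENNReal}
    (hM : ((hν.restrict_norm_lt ε).smul t).law.conv
      (ENNReal.ofReal t • ν.restrict {y | ρ ≤ ‖y‖}) ≤ M • V) :
    P ≤ ((hν.restrict_norm_lt ρ).smul t).law + M • V := by
  have hfin := hν.isFiniteMeasure_restrict hρ
  have hfin2 : IsFiniteMeasure (ENNReal.ofReal t • ν.restrict {y | ρ ≤ ‖y‖}) :=
    Measure.smul_finite _ ENNReal.ofReal_ne_top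
  set l := ENNReal.ofReal t • ν.restrict {y | ρ ≤ ‖y‖} with hl
  have hls : IsSymmLevyMeasure l := (hν.restrict_norm_ge ρ).smul t
  set L := ((hν.restrict_norm_lt ρ).smul t).law with hL
  set S := ((hν.restrict_norm_lt ε).smul t).law with hS
  set G := (((hν.restrict_norm_lt ρ).restrict_norm_ge ε).smul t).law with hG
  have hPL : P = L.conv (compoundPoisson l) := by
    refine Measure.ext_of_charFun (funext fun ξ => ?_)
    rw [hP, charFun_conv, hL, (hν.restrict_norm_lt ρ).charFun_law_smul ht,
      hls.charFun_compoundPoisson,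
      hl, levyExponent_smul ht, ← Complex.ofReal_mul, ← Real.exp_add, ← hν.levyExponent_add ρ]
    congr 2
    ring
  have hLS : L = S.conv G := by
    have hsub : {y : EuclideanSpace ℝ (Fin d) | ‖y‖ < ε} ⊆ {y | ‖y‖ < ρ} :=
      fun y hy => lt_of_lt_of_le (show ‖y‖ < ε from hy) hερ
    refine Measure.ext_of_charFun (funext fun ξ => ?_)
    have h := (hν.restrict_norm_lt ρ).levyExponent_add ε ξ
    rw [Measure.restrict_restrict_of_subset hsub] at h
    rw [charFun_conv, hL, hS, hG, (hν.restrict_norm_lt ρ).charFun_law_smul ht,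
      (hν.restrict_norm_lt ε).charFun_law_smul ht,
      ((hν.restrict_norm_lt ρ).restrict_norm_ge ε).charFun_law_smul ht, ← Complex.ofReal_mul,
        ← Real.exp_add, ← h]
    congr 2
    ring
  -- Regroup so that `S ∗ l` carries the bound; the other factor, `G ∗ compoundPoisson l`, is a
  -- probability and preserves it.
  have h1 : L.conv (l.conv (compoundPoisson l)) ≤ M • V := by
    have h2 : L.conv (l.conv (compoundPoisson l))
        = (G.conv (compoundPoisson l)).conv (S.conv l) := by
      rw [hLS, Measure.conv_comm l, Measure.conv_comm S G, Measure.conv_assoc,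
        Measure.conv_assoc, ← Measure.conv_assoc S, Measure.conv_comm S (compoundPoisson l),
        Measure.conv_assoc]
    rw [h2]
    refine (conv_le_smul _ _ V hM).trans_eq ?_
    rw [measure_univ, one_mul]
  calc P = L.conv (compoundPoisson l) := hPL
    _ ≤ L.conv (Measure.dirac 0 + l.conv (compoundPoisson l)) :=
        conv_mono_right _ (compoundPoisson_le l)
    _ = L + L.conv (l.conv (compoundPoisson l)) := by
        rw [Measure.conv_add, Measure.conv_dirac_zero]
    _ ≤ L + M • V := by gcongr

end IsSymmLevyMeasure

/-- Apply `conv_self_apply_le` to the law at time `t/2`: this is the source of `t / 2` in the base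
and of `8d` in place of `4d` in the exponent. -/
theorem exists_law_restrict_apply_le (hd : 0 < d) {α A c₀ : ℝ} (hα : α ∈ Ioo (0 : ℝ) 2)
    (hA : 0 ≤ A) (hc₀ : 0 < c₀) :
    ∃ C : ℝ, 0 < C ∧ ∀ (ν : Measure (EuclideanSpace ℝ (Fin d))) (hν : IsSymmLevyMeasure ν),
      (∀ ρ : ℝ, 0 < ρ → ν {y | ρ ≤ ‖y‖} ≤ ENNReal.ofReal (A * ρ ^ (-α))) →
      (∀ ξ : EuclideanSpace ℝ (Fin d), 1 < ‖ξ‖ → c₀ * ‖ξ‖ ^ α ≤ levyExponent ν ξ) →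
      ∀ t ρ r : ℝ, 0 < t → t ≤ 1 → 0 < ρ → t ≤ ρ ^ α → 0 ≤ r →
        ∀ B : Set (EuclideanSpace ℝ (Fin d)), MeasurableSet B → B ⊆ {y | r ≤ ‖y‖} →
          ((hν.restrict_norm_lt ρ).smul t).law B ≤
            ENNReal.ofReal (C * t ^ (-(d : ℝ) / α) * (t / 2 / ρ ^ α) ^ (r / (8 * d * ρ))) *
              volume B := by
  have h2α : 0 < 2 - α := by linarith [hα.2]
  have hα0 := hα.1
  have hd' : (0 : ℝ) < d := by exact_mod_cast hd
  set J := ∫ ξ : EuclideanSpace ℝ (Fin d), Real.exp (-c₀ * ‖ξ‖ ^ α) with hJ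
  have hJ0 : 0 ≤ J := integral_nonneg fun _ => (Real.exp_pos _).le
  set C1 := Real.exp (2 * A + c₀) * J with hC1
  have hC10 : 0 ≤ C1 := by positivity
  set C2 := 2 * d * Real.exp (4 * A / (2 - α)) with hC2
  have hC20 : 0 < C2 := by positivity
  refine ⟨2 * (C2 * (C1 * (2⁻¹) ^ (-(d : ℝ) / α))) + 1, by positivity, ?_⟩
  intro ν hν htail hlow t ρ r ht ht1 hρ htρ hr B hB hBr
  have hs : 0 < t / 2 := by positivity
  have hs1 : t / 2 ≤ 1 := by linarith
  have hsρ : t / 2 ≤ ρ ^ α := by linarith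
  set Q := ((hν.restrict_norm_lt ρ).smul (t / 2)).law with hQ
  have hchar := norm_charFun_law_restrict_le hν hα0 hA hc₀ htail hlow hs hs1 hρ hsρ
  have hvol : Q ≤ ENNReal.ofReal (C1 * (t / 2) ^ (-(d : ℝ) / α)) • volume := by
    refine (measure_le_integral_norm_charFun
      (integrable_charFun_of_le' hd hα0 (mul_pos hc₀ hs) hchar)).trans ?_
    gcongr
    exact integral_norm_charFun_le hd hα0 hc₀ hs hchar
  have htl := law_restrict_norm_ge_le hα hA hd hν htail hρ hs hsρ (r := r / 2) (by positivity)
  have hsum : ((hν.restrict_norm_lt ρ).smul t).law = Q.conv Q := by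
    rw [hQ, ← (hν.restrict_norm_lt ρ).law_smul_add hs.le hs.le]
    congr 1
    ring_nf
  rw [hsum]
  refine (conv_self_apply_le Q volume hvol htl hB hBr).trans ?_
  have htwo (x : ℝ) : (2 : ENNReal) * ENNReal.ofReal x = ENNReal.ofReal (2 * x) := by
    rw [ENNReal.ofReal_mul (by norm_num), ENNReal.ofReal_ofNat]
  rw [← ENNReal.ofReal_mul (by positivity), htwo]
  refine mul_le_mul_left (ENNReal.ofReal_le_ofReal ?_) _
  have h1 : r / 2 / (4 * d * ρ) = r / (8 * d * ρ) := by
    rw [div_div]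
    congr 1
    ring
  rw [h1, div_eq_mul_inv t 2, Real.mul_rpow ht.le (by norm_num)]
  have h2 : 0 ≤ t ^ (-(d : ℝ) / α) * (t * 2⁻¹ / ρ ^ α) ^ (r / (8 * d * ρ)) := by positivity
  rw [← hC2]
  nlinarith

theorem summable_half_rpow_mul_rpow (hd : 0 < d) (γ : ℝ) :
    Summable fun k : ℕ => (2⁻¹ : ℝ) ^ ((k : ℝ) / (8 * d)) * ((k : ℝ) + 1) ^ γ := by
  have hd' : (0 : ℝ) < d := by exact_mod_cast hd
  set b : ℝ := (2⁻¹ : ℝ) ^ ((1 : ℝ) / (8 * d)) with hb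
  have hb0 : 0 < b := by positivity
  have hb1 : b < 1 := Real.rpow_lt_one (by norm_num) (by norm_num) (by positivity)
  have h1 := summable_pow_mul_geometric_of_norm_lt_one ⌈γ⌉₊ (r := b)
    (by rwa [Real.norm_of_nonneg hb0.le])
  have h2 := ((summable_nat_add_iff 1).2 h1).mul_left b⁻¹
  refine Summable.of_nonneg_of_le (fun k => by positivity) (fun k => ?_) h2
  have h3 : (2⁻¹ : ℝ) ^ ((k : ℝ) / (8 * d)) = b ^ k := by
    rw [hb, ← Real.rpow_natCast, ← Real.rpow_mul (by norm_num)]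
    congr 1
    ring
  have h4 : ((k : ℝ) + 1) ^ γ ≤ ((k : ℝ) + 1) ^ ⌈γ⌉₊ := by
    rw [← Real.rpow_natCast]
    exact Real.rpow_le_rpow_of_exponent_le (by linarith [Nat.cast_nonneg (α := ℝ) k])
      (Nat.le_ceil γ)
  rw [h3]
  push_cast
  calc b ^ k * ((k : ℝ) + 1) ^ γ ≤ b ^ k * ((k : ℝ) + 1) ^ ⌈γ⌉₊ := by gcongr
    _ = _ := by
        rw [pow_succ]
        field_simp

/-- At the critical cutoff `ε^α = t` the base `t / 2 / ε^α` equals `1/2`, so the annulus weights are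
geometric and absorb the growth `(k+1)^γ` of the ball masses. -/
theorem exists_law_restrict_conv_le (hd : 0 < d) {α A c₀ : ℝ} (hα : α ∈ Ioo (0 : ℝ) 2)
    (hA : 0 ≤ A) (hc₀ : 0 < c₀) (γ : ℝ) :
    ∃ C : ℝ, 0 < C ∧ ∀ (ν : Measure (EuclideanSpace ℝ (Fin d))) (hν : IsSymmLevyMeasure ν),
      (∀ ρ : ℝ, 0 < ρ → ν {y | ρ ≤ ‖y‖} ≤ ENNReal.ofReal (A * ρ ^ (-α))) →
      (∀ ξ : EuclideanSpace ℝ (Fin d), 1 < ‖ξ‖ → c₀ * ‖ξ‖ ^ α ≤ levyExponent ν ξ) →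
      ∀ t ε : ℝ, 0 < t → t ≤ 1 → 0 < ε → ε ^ α = t →
        ∀ (l : Measure (EuclideanSpace ℝ (Fin d))) (B : ℝ), IsFiniteMeasure l → 0 ≤ B →
          (∀ (w : EuclideanSpace ℝ (Fin d)) (r : ℝ), 0 < r →
            l (Metric.ball w r) ≤ ENNReal.ofReal (B * r ^ γ)) →
          ((hν.restrict_norm_lt ε).smul t).law.conv l ≤
            ENNReal.ofReal (C * t ^ (-(d : ℝ) / α) * ε ^ γ * B) • volume := by
  obtain ⟨C, hC, h⟩ := exists_law_restrict_apply_le hd hα hA hc₀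
  have hsum := summable_half_rpow_mul_rpow hd γ
  set S := ∑' k : ℕ, (2⁻¹ : ℝ) ^ ((k : ℝ) / (8 * d)) * ((k : ℝ) + 1) ^ γ with hS
  have hS0 : 0 ≤ S := tsum_nonneg fun k => by positivity
  refine ⟨C * (S + 1), by positivity, ?_⟩
  intro ν hν htail hlow t ε ht ht1 hε hεt l B hl hB hball
  have hd' : (0 : ℝ) < d := by exact_mod_cast hd
  have hbound := conv_le_of_annulus_bounds ((hν.restrict_norm_lt ε).smul t).law l volume hε
    (D := fun k => ENNReal.ofReal (C * t ^ (-(d : ℝ) / α) * 2⁻¹ ^ ((k : ℝ) / (8 * d))))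
    (b := fun k => ENNReal.ofReal (B * (((k : ℝ) + 1) * ε) ^ γ))
    (fun k A hAm hAk => by
      have h1 := h ν hν htail hlow t ε (k * ε) ht ht1 hε hεt.ge (by positivity) A hAm hAk
      have h2 : t / 2 / ε ^ α = 2⁻¹ := by
        rw [hεt]
        field_simp
      have h3 : (k : ℝ) * ε / (8 * d * ε) = k / (8 * d) := by field_simp
      rwa [h2, h3] at h1)
    (fun k w => hball w _ (by positivity))
  refine hbound.trans ?_
  gcongr
  calc ∑' k : ℕ, ENNReal.ofReal (C * t ^ (-(d : ℝ) / α) * 2⁻¹ ^ ((k : ℝ) / (8 * d))) *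
        ENNReal.ofReal (B * (((k : ℝ) + 1) * ε) ^ γ)
      = ∑' k : ℕ, ENNReal.ofReal (C * t ^ (-(d : ℝ) / α) * ε ^ γ * B *
          (2⁻¹ ^ ((k : ℝ) / (8 * d)) * ((k : ℝ) + 1) ^ γ)) := by
        refine tsum_congr fun k => ?_
        rw [← ENNReal.ofReal_mul (by positivity), Real.mul_rpow (by positivity) hε.le]
        congr 1
        ring
    _ = ENNReal.ofReal (C * t ^ (-(d : ℝ) / α) * ε ^ γ * B * S) := by
        rw [← ENNReal.ofReal_tsum_of_nonneg (fun k => by positivity) (hsum.mul_left _),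
          tsum_mul_left]
    _ ≤ _ := by
        refine ENNReal.ofReal_le_ofReal ?_
        have : 0 ≤ C * t ^ (-(d : ℝ) / α) * ε ^ γ * B := by positivity
        nlinarith

end LawBounds

/-! ### Polynomial lower bounds from doubling. -/

section Doubling

variable {q : ℝ → ℝ} {K : ℝ}

theorem le_pow_mul_of_doubling (hK : 1 ≤ K) (hq_doubling : ∀ s, 0 < s → q s ≤ K * q (2 * s))
    {s : ℝ} (hs : 0 < s) (n : ℕ) : q s ≤ K ^ n * q (2 ^ n * s) := by
  induction n with
  | zero => simp
  | succ n ih =>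
    refine ih.trans ?_
    rw [pow_succ, mul_assoc, pow_succ', mul_assoc 2]
    gcongr
    exact hq_doubling _ (by positivity)

/-- A doubling nonincreasing function decays at most polynomially. -/
theorem div_pow_mul_le_of_doubling (hK : 1 ≤ K) (hq_pos : ∀ s, 0 < s → 0 < q s)
    (hq_anti : AntitoneOn q (Ioi 0)) (hq_doubling : ∀ s, 0 < s → q s ≤ K * q (2 * s))
    {m : ℕ} (hm : K ≤ 2 ^ m) {ε R : ℝ} (hε : 0 < ε) (hε1 : ε ≤ 1) (hεR : ε ≤ R) :
    (ε / R) ^ m * q 1 ≤ K * q R := by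
  have hR : 0 < R := hε.trans_le hεR
  have hq1 := hq_pos 1 one_pos
  have hqR := hq_pos R hR
  rcases le_or_gt R 1 with h | h
  · calc (ε / R) ^ m * q 1 ≤ 1 * q 1 := by
          gcongr
          exact pow_le_one₀ (by positivity) (div_le_one_of_le₀ hεR hR.le)
      _ ≤ 1 * q R := by
          gcongr
          exact hq_anti hR (mem_Ioi.2 one_pos) h
      _ ≤ K * q R := by gcongr
  -- With `2^n ≤ R < 2^(n+1)`, going from `1` past `R` takes `n + 1` doublings; the extra one is the
  -- factor `K` in the conclusion.
  · obtain ⟨n, hn1, hn2⟩ := exists_nat_pow_near h.le one_lt_two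
    have h1 := le_pow_mul_of_doubling hK hq_doubling one_pos (n + 1)
    rw [mul_one] at h1
    have h2 : q (2 ^ (n + 1)) ≤ q R := hq_anti hR (by simp) hn2.le
    have h0 : 0 ≤ q (2 ^ (n + 1)) := (hq_pos _ (by positivity)).le
    have h3 : K ^ n ≤ R ^ m := by
      calc K ^ n ≤ (2 ^ m) ^ n := by gcongr
        _ = (2 ^ n) ^ m := by rw [← pow_mul, ← pow_mul, mul_comm]
        _ ≤ R ^ m := by gcongr
    calc (ε / R) ^ m * q 1 ≤ (1 / R) ^ m * (K ^ (n + 1) * q (2 ^ (n + 1))) := by gcongr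
      _ ≤ (1 / R) ^ m * (R ^ m * K * q R) := by
          rw [pow_succ K]
          gcongr
      _ = K * q R := by
          rw [div_pow, one_pow]
          field_simp

end Doubling

/-! ### Comparison of the two forms of the bound. -/

section Comparison

theorem rpow_mul_rpow_eq {α γ t R D : ℝ} (hα : 0 < α) (ht : 0 < t) (hR : 0 < R) :
    t ^ (1 + (γ - D) / α) * R ^ (-α - γ) = t ^ (-D / α) * (t ^ (1 / α) / R) ^ (α + γ) := by
  rw [Real.div_rpow (by positivity) hR.le, ← Real.rpow_mul ht.le, show -α - γ = -(α + γ) by ring,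
    Real.rpow_neg hR.le, mul_div_assoc', ← Real.rpow_add ht, div_eq_mul_inv]
  congr 2
  field_simp
  ring

theorem densityBound_eq {d : ℕ} {α γ t R : ℝ} {q : ℝ → ℝ} (hα : 0 < α) (ht : 0 < t)
    (hR : 0 < R) :
    densityBound d α γ q t R = min (t ^ (-(d : ℝ) / α))
      (t ^ (-(d : ℝ) / α) * ((t ^ (1 / α) / R) ^ (α + γ) * q R)) := by
  rw [densityBound, rpow_mul_rpow_eq hα ht hR, mul_assoc]

/-- In terms of `u = R / t^(1/α)`: for `u ≥ 1` use `1 + u ≤ 2u`; for `u < 1` one has `R < 1`, so `q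
R ≥ q 1`. The reverse inequality needs only `q ≤ M` and monotonicity of powers. -/
theorem densityBound_comparable (d : ℕ) {α γ M : ℝ} {q : ℝ → ℝ} (hα : 0 < α) (hγ : 0 < γ)
    (hq_pos : ∀ s, 0 < s → 0 < q s) (hq_bdd : ∀ s, 0 < s → q s ≤ M)
    (hq_anti : AntitoneOn q (Ioi 0)) :
    ∃ C' : ℝ, 0 < C' ∧ ∀ t ∈ Ioo (0 : ℝ) 1, ∀ R : ℝ, 0 < R →
      C'⁻¹ * densityBound d α γ q t R ≤
          t ^ (-(d : ℝ) / α) * (1 + t ^ (-1 / α) * R) ^ (-α - γ) * q R ∧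
        t ^ (-(d : ℝ) / α) * (1 + t ^ (-1 / α) * R) ^ (-α - γ) * q R ≤
          C' * densityBound d α γ q t R := by
  have hq1 := hq_pos 1 one_pos
  have hM : 0 < M := hq1.trans_le (hq_bdd 1 one_pos)
  have ha : 0 < α + γ := by linarith
  have hC' : (0 : ℝ) < 2 ^ (α + γ) * (1 + 1 / q 1) + 1 + M := by positivity
  refine ⟨2 ^ (α + γ) * (1 + 1 / q 1) + 1 + M, hC', fun t ht R hR => ?_⟩
  have ht0 := ht.1
  have hqR := hq_pos R hR
  rw [densityBound_eq hα ht0 hR]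
  set Ab := t ^ (-(d : ℝ) / α)
  have hAb : 0 < Ab := by positivity
  have hε : t ^ (1 / α) ≤ 1 := Real.rpow_le_one ht0.le ht.2.le (by positivity)
  have hεi : t ^ (-1 / α) = (t ^ (1 / α))⁻¹ := by
    rw [neg_div, Real.rpow_neg ht0.le]
  set ε := t ^ (1 / α)
  have hε0 : 0 < ε := by positivity
  have hu : t ^ (-1 / α) * R = R / ε := by rw [hεi]; ring
  rw [hu]
  set u := R / ε with hudef
  have hu0 : 0 < u := by positivity
  have hεu : ε / R = u⁻¹ := by rw [hudef, inv_div]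
  have hneg (x : ℝ) (hx : 0 < x) : x ^ (-α - γ) = (x ^ (α + γ))⁻¹ := by
    rw [show -α - γ = -(α + γ) by ring, Real.rpow_neg hx.le]
  rw [hεu, hneg _ (by positivity), Real.inv_rpow hu0.le]
  have h1u : 0 < (1 + u) ^ (α + γ) := by positivity
  constructor
  · rw [inv_mul_le_iff₀ hC']
    rcases le_or_gt 1 u with h | h
    · refine (min_le_right _ _).trans ?_
      have h2 : (1 + u) ^ (α + γ) ≤ 2 ^ (α + γ) * u ^ (α + γ) := by
        rw [← Real.mul_rpow (by norm_num) hu0.le]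
        gcongr
        linarith
      have h3 : (u ^ (α + γ))⁻¹ ≤ 2 ^ (α + γ) * ((1 + u) ^ (α + γ))⁻¹ := by
        rw [← div_eq_mul_inv, le_div_iff₀ h1u, inv_mul_le_iff₀ (by positivity)]
        linarith
      calc Ab * ((u ^ (α + γ))⁻¹ * q R)
          ≤ Ab * (2 ^ (α + γ) * ((1 + u) ^ (α + γ))⁻¹ * q R) := by gcongr
        _ = 2 ^ (α + γ) * (Ab * ((1 + u) ^ (α + γ))⁻¹ * q R) := by ring
        _ ≤ _ := by
            gcongr
            have : 0 ≤ 2 ^ (α + γ) * (1 / q 1) := by positivity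
            linarith
    · refine (min_le_left _ _).trans ?_
      have hRε : R < 1 := by
        have : R < ε := (div_lt_one hε0).1 h
        linarith
      have hq1R : q 1 ≤ q R := hq_anti hR (mem_Ioi.2 one_pos) hRε.le
      have h2 : (1 + u) ^ (α + γ) ≤ 2 ^ (α + γ) := by
        gcongr
        linarith
      have h3 : 1 ≤ 2 ^ (α + γ) * ((1 + u) ^ (α + γ))⁻¹ := by
        rw [← div_eq_mul_inv, le_div_iff₀ h1u]
        linarith
      have h4 : 1 ≤ 1 / q 1 * q R := by
        rw [one_div, ← div_eq_inv_mul, le_div_iff₀ hq1]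
        linarith
      calc Ab = Ab * (1 * 1) := by ring
        _ ≤ Ab * (2 ^ (α + γ) * ((1 + u) ^ (α + γ))⁻¹ * (1 / q 1 * q R)) := by gcongr
        _ = 2 ^ (α + γ) * (1 / q 1) * (Ab * ((1 + u) ^ (α + γ))⁻¹ * q R) := by ring
        _ ≤ _ := by
            gcongr
            have : (0 : ℝ) ≤ 2 ^ (α + γ) := by positivity
            linarith
  · rw [mul_min_of_nonneg _ _ hC'.le]
    have hone : (1 : ℝ) ≤ (1 + u) ^ (α + γ) := Real.one_le_rpow (by linarith) ha.le
    refine le_min ?_ ?_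
    · calc Ab * ((1 + u) ^ (α + γ))⁻¹ * q R ≤ Ab * 1 * M := by
            gcongr
            · exact inv_le_one_of_one_le₀ hone
            · exact hq_bdd R hR
        _ = M * Ab := by ring
        _ ≤ _ := by
            gcongr
            have : 0 ≤ 2 ^ (α + γ) * (1 + 1 / q 1) := by positivity
            linarith
    · calc Ab * ((1 + u) ^ (α + γ))⁻¹ * q R ≤ Ab * (u ^ (α + γ))⁻¹ * q R := by
            gcongr
            linarith
        _ = 1 * (Ab * ((u ^ (α + γ))⁻¹ * q R)) := by ring
        _ ≤ _ := by
            gcongr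
            have : 0 ≤ 2 ^ (α + γ) * (1 + 1 / q 1) := by positivity
            linarith

end Comparison

/-! ### Smoothness and the on-diagonal bound. -/

section DensityEstimates

variable {d : ℕ} {ν P : Measure (EuclideanSpace ℝ (Fin d))} {α c₀ t : ℝ}

theorem norm_charFun_le_of_lower_bound (hα : 0 < α) (hc₀ : 0 < c₀) (ht : 0 < t)
    (hlow : ∀ ξ : EuclideanSpace ℝ (Fin d), 1 < ‖ξ‖ → c₀ * ‖ξ‖ ^ α ≤ levyExponent ν ξ)
    (hP : ∀ ξ, charFun P ξ = ((Real.exp (-(t * levyExponent ν ξ)) : ℝ) : ℂ))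
    (ξ : EuclideanSpace ℝ (Fin d)) :
    ‖charFun P ξ‖ ≤ Real.exp (c₀ * t) * Real.exp (-(c₀ * t) * ‖ξ‖ ^ α) := by
  rw [hP, Complex.norm_real, Real.norm_of_nonneg (Real.exp_nonneg _)]
  have := exp_neg_le_of_lower_bound (b := 0) hα hc₀ ht (norm_nonneg ξ)
    (levyExponent_nonneg (ν := ν) ξ) le_rfl (fun h => by linarith [hlow ξ h])
  simpa using this

theorem isSmoothBoundedDensity_fourierDensity [IsFiniteMeasure P] (hd : 0 < d) (hα : 0 < α)
    (hc₀ : 0 < c₀) (ht : 0 < t)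
    (hlow : ∀ ξ : EuclideanSpace ℝ (Fin d), 1 < ‖ξ‖ → c₀ * ‖ξ‖ ^ α ≤ levyExponent ν ξ)
    (hP : ∀ ξ, charFun P ξ = ((Real.exp (-(t * levyExponent ν ξ)) : ℝ) : ℂ)) :
    IsSmoothBoundedDensity P (fourierDensity P) := by
  have hchar := norm_charFun_le_of_lower_bound hα hc₀ ht hlow hP
  have hint := integrable_charFun_of_le' hd hα (mul_pos hc₀ ht) hchar
  exact
    { smooth := contDiff_fourierDensity (integrable_charFun_of_le hd hα (mul_pos hc₀ ht) hchar)
      nonneg := (fourierDensity_nonneg_and_eq_withDensity hint).1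
      bounded := ⟨_, fun x => (le_abs_self _).trans (abs_fourierDensity_le P x)⟩
      eq_withDensity := (fourierDensity_nonneg_and_eq_withDensity hint).2 }

theorem fourierDensity_le [IsFiniteMeasure P] (hd : 0 < d) (hα : 0 < α)
    (hc₀ : 0 < c₀) (ht : 0 < t) (ht1 : t ≤ 1)
    (hlow : ∀ ξ : EuclideanSpace ℝ (Fin d), 1 < ‖ξ‖ → c₀ * ‖ξ‖ ^ α ≤ levyExponent ν ξ)
    (hP : ∀ ξ, charFun P ξ = ((Real.exp (-(t * levyExponent ν ξ)) : ℝ) : ℂ))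
    (x : EuclideanSpace ℝ (Fin d)) :
    fourierDensity P x ≤
      Real.exp c₀ * (∫ ξ : EuclideanSpace ℝ (Fin d), Real.exp (-c₀ * ‖ξ‖ ^ α)) *
        t ^ (-(d : ℝ) / α) := by
  refine (le_abs_self _).trans ((abs_fourierDensity_le P x).trans
    (integral_norm_charFun_le hd hα hc₀ ht fun ξ =>
      (norm_charFun_le_of_lower_bound hα hc₀ ht hlow hP ξ).trans ?_))
  gcongr
  exact mul_le_of_le_one_right hc₀.le ht1

end DensityEstimates

/-! ### The off-diagonal bound. -/

section FarEstimate

theorem exists_fourierDensity_le (d : ℕ) {α γ K A A' c₀ : ℝ} (hd : 0 < d)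
    (hα : α ∈ Ioo (0 : ℝ) 2) (hγ : 1 ≤ γ) (hK : 1 ≤ K) (hc₀ : 0 < c₀) (hA : 0 ≤ A) (hA' : 0 ≤ A')
    {q : ℝ → ℝ} (hq_pos : ∀ s, 0 < s → 0 < q s) (hq_anti : AntitoneOn q (Ioi 0))
    (hq_doubling : ∀ s, 0 < s → q s ≤ K * q (2 * s)) :
    ∃ C : ℝ, 0 < C ∧ ∀ ν : Measure (EuclideanSpace ℝ (Fin d)), IsSymmLevyMeasure ν →
      (∀ ρ : ℝ, 0 < ρ → ν {y | ρ ≤ ‖y‖} ≤ ENNReal.ofReal (A * ρ ^ (-α))) →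
      (∀ ξ : EuclideanSpace ℝ (Fin d), 1 < ‖ξ‖ → c₀ * ‖ξ‖ ^ α ≤ levyExponent ν ξ) →
      (∀ (w : EuclideanSpace ℝ (Fin d)) (r ρ : ℝ), 0 < r → 0 < ρ →
        ν (Metric.ball w r ∩ {y | ρ ≤ ‖y‖}) ≤
          ENNReal.ofReal (A' * r ^ γ * ρ ^ (-α - γ) * q ρ)) →
      ∀ (t : ℝ) (P : Measure (EuclideanSpace ℝ (Fin d))), t ∈ Ioo (0 : ℝ) 1 →
        IsFiniteMeasure P →
        (∀ ξ, charFun P ξ = ((Real.exp (-(t * levyExponent ν ξ)) : ℝ) : ℂ)) →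
        ∀ x, fourierDensity P x ≤ C * t ^ (-(d : ℝ) / α) ∧
          (x ≠ 0 → fourierDensity P x ≤
            C * (t ^ (-(d : ℝ) / α) * ((t ^ (1 / α) / ‖x‖) ^ (α + γ) * q ‖x‖))) := by
  have hα0 := hα.1
  have hd' : (0 : ℝ) < d := by exact_mod_cast hd
  have ha : 0 < α + γ := by linarith
  have hq1 := hq_pos 1 one_pos
  obtain ⟨C4, hC4, h4⟩ := exists_law_restrict_apply_le hd hα hA hc₀
  obtain ⟨C5, hC5, h5⟩ := exists_law_restrict_conv_le hd hα hA hc₀ γ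
  obtain ⟨m, hm⟩ : ∃ m : ℕ, K ≤ 2 ^ m :=
    (pow_unbounded_of_one_lt K one_lt_two).imp fun _ h => h.le
  -- `L = 2^j` is chosen so that the small-jump exponent `αL/(16d)` reaches `α + γ + m`, the extra
  -- `m` compensating the decay of `q`; a power of two makes `q (R/L) ≤ K^j q R` a matter of `j`
  -- doublings.
  obtain ⟨j, hj⟩ : ∃ j : ℕ, (α + γ + m) * (16 * d) / α ≤ 2 ^ j :=
    (pow_unbounded_of_one_lt _ one_lt_two).imp fun _ h => h.le
  set C3 := Real.exp c₀ * ∫ ξ : EuclideanSpace ℝ (Fin d), Real.exp (-c₀ * ‖ξ‖ ^ α) with hC3def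
  have hC3 : 0 ≤ C3 := mul_nonneg (Real.exp_nonneg _) (integral_nonneg fun _ => Real.exp_nonneg _)
  have hL : (0 : ℝ) < 2 ^ j := by positivity
  set L : ℝ := 2 ^ j with hLdef
  have hL1 : 1 ≤ L := one_le_pow₀ one_le_two
  have hqL := hq_pos L hL
  set c1 := C4 * (L ^ (α + γ + m) * (K / q 1)) with hc1
  set c2 := C5 * A' * L ^ (α + γ) * K ^ j with hc2
  set c3 := C3 * L ^ (α + γ) / q L with hc3
  have hc1' : 0 ≤ c1 := by positivity
  have hc2' : 0 ≤ c2 := by positivity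
  have hc3' : 0 ≤ c3 := by positivity
  refine ⟨C3 + (c1 + c2) + c3 + 1, by positivity, ?_⟩
  intro ν hν htail hlow hball t P ht hPf hP x
  have ht0 := ht.1
  have hnear := fourierDensity_le hd hα0 hc₀ ht0 ht.2.le hlow hP x
  rw [← hC3def] at hnear
  set Ab := t ^ (-(d : ℝ) / α) with hAb
  have hAb0 : 0 < Ab := by positivity
  refine ⟨hnear.trans (by gcongr; linarith), fun hx => ?_⟩
  set R := ‖x‖ with hRdef
  have hR : 0 < R := norm_pos_iff.2 hx
  set ε := t ^ (1 / α) with hε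
  have hε0 : 0 < ε := by positivity
  have hε1 : ε ≤ 1 := Real.rpow_le_one ht0.le ht.2.le (by positivity)
  have hεt : ε ^ α = t := by
    rw [hε, ← Real.rpow_mul ht0.le, one_div_mul_cancel hα0.ne', Real.rpow_one]
  have hqR := hq_pos R hR
  have hfactor : 0 < Ab * ((ε / R) ^ (α + γ) * q R) := by positivity
  -- For `R < Lε ≤ L` both `(Lε/R)^(α+γ) ≥ 1` and `q R ≥ q L`, so the on-diagonal bound suffices.
  rcases lt_or_ge R (L * ε) with hRL | hRL
  · have h1 : q L ≤ q R := hq_anti hR hL (hRL.le.trans (mul_le_of_le_one_right hL.le hε1))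
    have h2 : 1 ≤ L ^ (α + γ) * (ε / R) ^ (α + γ) := by
      rw [← Real.mul_rpow hL.le (by positivity)]
      refine Real.one_le_rpow ?_ ha.le
      rw [mul_div_assoc', one_le_div hR]
      exact hRL.le
    calc fourierDensity P x ≤ C3 * Ab := hnear
      _ = C3 * Ab * (1 * (q L / q L)) := by
          rw [div_self hqL.ne', mul_one, mul_one]
      _ ≤ C3 * Ab * (L ^ (α + γ) * (ε / R) ^ (α + γ) * (q R / q L)) := by gcongr
      _ = c3 * (Ab * ((ε / R) ^ (α + γ) * q R)) := by
          rw [hc3]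
          ring
      _ ≤ _ := by
          gcongr
          linarith
  · set ρ := R / L with hρdef
    have hρ : 0 < ρ := by positivity
    have hερ : ε ≤ ρ := by
      rw [hρdef, le_div_iff₀ hL]
      linarith
    have hεR : ε ≤ R := by nlinarith
    have htρ : t ≤ ρ ^ α := by
      rw [← hεt]
      gcongr
    have hqρ := hq_pos ρ hρ
    have hLR : L * ρ = R := by
      rw [hρdef]
      field_simp
    have hεL : ε / ρ = L * (ε / R) := by
      rw [hρdef]
      field_simp
    have hqρR : q ρ ≤ K ^ j * q R := by
      have := le_pow_mul_of_doubling hK hq_doubling hρ j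
      rwa [← hLdef, hLR] at this
    have hdecay := div_pow_mul_le_of_doubling hK hq_pos hq_anti hq_doubling hm hε0 hε1 hεR
    -- Small-jump term: `m` of the powers of `ε/R` are traded for `q R` through `hdecay`.
    have hsmall : (t / 2 / ρ ^ α) ^ (R / 2 / (8 * d * ρ)) ≤
        L ^ (α + γ + m) * (K / q 1) * ((ε / R) ^ (α + γ) * q R) := by
      have hbase : t / 2 / ρ ^ α ≤ (ε / ρ) ^ α := by
        rw [Real.div_rpow hε0.le hρ.le, hεt]
        gcongr
        linarith
      have hexp : R / 2 / (8 * d * ρ) = L / (16 * d) := by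
        rw [← hLR]
        field_simp
        norm_num
      have hαL : α + γ + m ≤ α * (L / (16 * d)) := by
        rw [div_le_iff₀ hα0] at hj
        rw [mul_div_assoc', le_div_iff₀ (by positivity)]
        linarith
      calc (t / 2 / ρ ^ α) ^ (R / 2 / (8 * d * ρ))
          ≤ ((ε / ρ) ^ α) ^ (L / (16 * d)) := by
            rw [hexp]
            gcongr
        _ = (ε / ρ) ^ (α * (L / (16 * d))) := by rw [Real.rpow_mul (by positivity)]
        _ ≤ (ε / ρ) ^ (α + γ + m) :=
            Real.rpow_le_rpow_of_exponent_ge (by positivity) ((div_le_one hρ).2 hερ) hαL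
        _ = L ^ (α + γ + m) * ((ε / R) ^ (α + γ) * ((ε / R) ^ m * q 1 / q 1)) := by
            rw [mul_div_cancel_right₀ _ hq1.ne', hεL, Real.mul_rpow hL.le (by positivity),
              Real.rpow_add (by positivity : 0 < ε / R), Real.rpow_natCast]
        _ ≤ L ^ (α + γ + m) * ((ε / R) ^ (α + γ) * (K * q R / q 1)) := by gcongr
        _ = _ := by ring
    have hlfin : IsFiniteMeasure (ENNReal.ofReal t • ν.restrict {y | ρ ≤ ‖y‖}) := by
      have := hν.isFiniteMeasure_restrict hρ
      exact Measure.smul_finite _ ENNReal.ofReal_ne_top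
    have hconv := h5 ν hν htail hlow t ε ht0 ht.2.le hε0 hεt
      (ENNReal.ofReal t • ν.restrict {y | ρ ≤ ‖y‖}) (t * (A' * ρ ^ (-α - γ) * q ρ)) hlfin
      (by positivity) (fun w r hr => by
        rw [Measure.smul_apply, Measure.restrict_apply Metric.isOpen_ball.measurableSet,
          smul_eq_mul]
        refine (mul_le_mul_right (hball w r ρ hr hρ) _).trans ?_
        rw [← ENNReal.ofReal_mul ht0.le]
        refine ENNReal.ofReal_le_ofReal (le_of_eq ?_)
        ring)
    have hle := hν.le_law_add_smul ht0.le hερ hρ hP hconv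
    -- Large-jump term: since `t = ε^α`, the powers combine to `(ε/ρ)^(α+γ)`, where `ε/ρ = L ε/R`.
    have hM : C5 * Ab * ε ^ γ * (t * (A' * ρ ^ (-α - γ) * q ρ)) ≤
        c2 * (Ab * ((ε / R) ^ (α + γ) * q R)) := by
      have h1 : ε ^ γ * t * ρ ^ (-α - γ) = L ^ (α + γ) * (ε / R) ^ (α + γ) := by
        rw [← Real.mul_rpow hL.le (by positivity), ← hεL, Real.div_rpow hε0.le hρ.le, ← hεt,
          show -α - γ = -(α + γ) by ring, Real.rpow_neg hρ.le, ← Real.rpow_add hε0, add_comm γ,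
          div_eq_mul_inv]
      calc C5 * Ab * ε ^ γ * (t * (A' * ρ ^ (-α - γ) * q ρ))
          = C5 * Ab * A' * (ε ^ γ * t * ρ ^ (-α - γ)) * q ρ := by ring
        _ ≤ C5 * Ab * A' * (ε ^ γ * t * ρ ^ (-α - γ)) * (K ^ j * q R) := by gcongr
        _ = _ := by
            rw [h1, hc2]
            ring
    have hchar := norm_charFun_le_of_lower_bound hα0 hc₀ ht0 hlow hP
    have hint := integrable_charFun_of_le' hd hα0 (mul_pos hc₀ ht0) hchar
    have hfar : fourierDensity P x ≤ (c1 + c2) * (Ab * ((ε / R) ^ (α + γ) * q R)) := by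
      -- By continuity it is enough to bound the measure inside the ball of radius `R/2` about `x`,
      -- all of whose points have norm at least `R/2`.
      refine le_of_withDensity_le (V := volume) (continuous_fourierDensity hint)
        Metric.isOpen_ball (Metric.mem_ball_self (half_pos hR)) (fun B hB hBU => ?_)
        (by positivity)
      rw [← (fourierDensity_nonneg_and_eq_withDensity hint).2]
      have hBR : B ⊆ {y | R / 2 ≤ ‖y‖} := fun y hy => by
        have h1 : ‖y - x‖ < R / 2 := mem_ball_iff_norm.1 (hBU hy)
        have h2 := norm_sub_norm_le x y
        rw [norm_sub_rev] at h2
        show R / 2 ≤ ‖y‖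
        linarith
      refine (hle B).trans ?_
      rw [Measure.add_apply, Measure.smul_apply, smul_eq_mul, add_mul (c1 : ℝ),
        ENNReal.ofReal_add (by positivity) (by positivity), add_mul]
      refine add_le_add ((h4 ν hν htail hlow t ρ (R / 2) ht0 ht.2.le hρ htρ (by positivity)
        B hB hBR).trans (mul_le_mul_left (ENNReal.ofReal_le_ofReal ?_) _))
        (mul_le_mul_left (ENNReal.ofReal_le_ofReal hM) _)
      calc C4 * Ab * (t / 2 / ρ ^ α) ^ (R / 2 / (8 * d * ρ))
          ≤ C4 * Ab * (L ^ (α + γ + m) * (K / q 1) * ((ε / R) ^ (α + γ) * q R)) := by gcongr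
        _ = _ := by
            rw [hc1]
            ring
    exact hfar.trans (mul_le_mul_of_nonneg_right (by linarith) hfactor.le)

end FarEstimate

theorem theorem1 (d : ℕ) (α γ K c c₀ : ℝ)
    (hα : α ∈ Ioo (0 : ℝ) 2) (hγ : γ ∈ Icc (1 : ℝ) d) (hK : 1 ≤ K) (hc : 0 < c) (hc₀ : 0 < c₀)
    (μ : Measure (Metric.sphere (0 : EuclideanSpace ℝ (Fin d)) 1)) [IsFiniteMeasure μ]
    (q : ℝ → ℝ)
    (hq_pos : ∀ s, 0 < s → 0 < q s)
    (hq_bdd : ∃ M : ℝ, ∀ s, 0 < s → q s ≤ M)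
    (hq_anti : AntitoneOn q (Ioi 0))
    (hq_doubling : ∀ s, 0 < s → q s ≤ K * q (2 * s))
    (hμ : ∀ (θ : Metric.sphere (0 : EuclideanSpace ℝ (Fin d)) 1) (r : ℝ), 0 < r → r < 1 / 2 →
      μ (Metric.ball θ r) ≤ ENNReal.ofReal (c * r ^ (γ - 1))) :
    (∃ C : ℝ, 0 < C ∧
      ∀ ν : Measure (EuclideanSpace ℝ (Fin d)), IsSymmLevyMeasure ν →
        (∀ ξ : EuclideanSpace ℝ (Fin d), 1 < ‖ξ‖ → c₀ * ‖ξ‖ ^ α ≤ levyExponent ν ξ) →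
        (∀ A : Set (EuclideanSpace ℝ (Fin d)), MeasurableSet A → ν A ≤ polarMass α q μ A) →
        (∃ P : ℝ → Measure (EuclideanSpace ℝ (Fin d)), IsLevySemigroup ν P) ∧
        ∀ P : ℝ → Measure (EuclideanSpace ℝ (Fin d)), IsLevySemigroup ν P →
          ∃ p : ℝ → EuclideanSpace ℝ (Fin d) → ℝ,
            (∀ t, 0 < t → IsSmoothBoundedDensity (P t) (p t)) ∧
            ∀ t ∈ Ioo (0 : ℝ) 1,
              p t 0 ≤ C * t ^ (-(d : ℝ) / α) ∧
              ∀ x : EuclideanSpace ℝ (Fin d), x ≠ 0 →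
                p t x ≤ C * densityBound d α γ q t ‖x‖) ∧
    (∃ C' : ℝ, 0 < C' ∧
      ∀ t ∈ Ioo (0 : ℝ) 1, ∀ x : EuclideanSpace ℝ (Fin d), x ≠ 0 →
        C'⁻¹ * densityBound d α γ q t ‖x‖ ≤
            t ^ (-(d : ℝ) / α) * (1 + t ^ (-1 / α) * ‖x‖) ^ (-α - γ) * q ‖x‖ ∧
          t ^ (-(d : ℝ) / α) * (1 + t ^ (-1 / α) * ‖x‖) ^ (-α - γ) * q ‖x‖ ≤
            C' * densityBound d α γ q t ‖x‖) := by
  obtain ⟨M, hM⟩ := hq_bdd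
  have hα0 := hα.1
  have hM0 : 0 < M := (hq_pos 1 one_pos).trans_le (hM 1 one_pos)
  have hd : 0 < d := by
    have : (1 : ℝ) ≤ d := hγ.1.trans hγ.2
    exact_mod_cast zero_lt_one.trans_le this
  constructor
  -- `A` comes from the polar tail bound with `q ≤ M`, and `A'` from the small-ball estimate.
  -- Neither depends on `ν`, which makes `C` uniform.
  · obtain ⟨C, hC, h⟩ := exists_fourierDensity_le d (A := μ.real univ / α * M)
      (A' := 2 * c * 4 ^ (γ - 1) + μ.real univ / α * 8 ^ γ) hd hα hγ.1 hK hc₀ (by positivity)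
      (by positivity) hq_pos hq_anti hq_doubling
    refine ⟨C, hC, fun ν hν hlow hpolar => ⟨⟨_, hν.isLevySemigroup_law⟩, fun P hP => ?_⟩⟩
    have htail (ρ : ℝ) (hρ : 0 < ρ) :
        ν {y | ρ ≤ ‖y‖} ≤ ENNReal.ofReal (μ.real univ / α * M * ρ ^ (-α)) := by
      refine (hpolar _ (measurableSet_le (by fun_prop) (by fun_prop))).trans
        ((polarMass_norm_ge_le hα0 hq_pos hq_anti hρ).trans (ENNReal.ofReal_le_ofReal ?_))
      rw [mul_right_comm]
      gcongr
      exact hM ρ hρ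
    have hball (w : EuclideanSpace ℝ (Fin d)) (r ρ : ℝ) (hr : 0 < r) (hρ : 0 < ρ) :=
      measure_ball_inter_norm_ge_le hγ.1 hα0 hc hq_pos hq_anti hμ hpolar w hr hρ
    refine ⟨fun t => fourierDensity (P t), fun t ht => ?_, fun t ht => ?_⟩
    · have := hP.prob t ht.le
      exact isSmoothBoundedDensity_fourierDensity hd hα0 hc₀ ht hlow (hP.charFun_eq t ht.le)
    · have := hP.prob t ht.1.le
      have hmain := h ν hν htail hlow hball t (P t) ht inferInstance (hP.charFun_eq t ht.1.le)
      refine ⟨(hmain 0).1, fun x hx => ?_⟩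
      rw [densityBound_eq hα0 ht.1 (norm_pos_iff.2 hx), mul_min_of_nonneg _ _ hC.le]
      exact le_min (hmain x).1 ((hmain x).2 hx)
  · obtain ⟨C', hC', h⟩ :=
      densityBound_comparable d (γ := γ) hα0 (by linarith [hγ.1]) hq_pos hM hq_anti
    exact ⟨C', hC', fun t ht x hx => h t ht ‖x‖ (norm_pos_iff.2 hx)⟩
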